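/- Let $V$ be a finite set and $\mathcal L=\{x\in[0,\infty)^V:\max_i x_i>1\}$. A multivariate Pareto distribution is a random vector $Y=(Y_i)_{i\in V}$ with values in $\mathcal L$ that satisfies $\mathbb P(Y\in tA)=t^{-1}\mathbb P(Y\in A)$ for all $t\ge 1$ and all Borel $A\subset\mathcal L$, and has normalized margins, i.e. $\mathbb P(Y_i>1)$ is the same for all $i\in V$. For $m\in V$ let $Y^m$ denote $Y$ conditioned on $\{Y_m>1\}$, and let $\mathcal L^m=\{x\in\mathcal L:x_m>1\}$. A random variable $P$ is standard Pareto if $\mathbb P(P\le x)=1-1/x$ for $x\ge1$. The extremal function of $Y$ relative to $m$ is the (unique in law) random vector $W^m=(W^m_i)_{i\in V}$ with non-negative entries and $W^m_m=1$ almost surely, such that $Y^m\overset{d}{=}P\,W^m$ with $P$ standard Pareto and independent of $W^m$. The vector $Y$ is an extremal graphical model on a graph $G=(V,E)$ if for all pairwise disjoint $A,B,C\subset V$ such that every path in $G$ from $A$ to $C$ contains a node of $B$, and for every $m\in V$, the vectors $Y^m_A$ and $Y^m_C$ are conditionally independent given $Y^m_B$. Let $T=(V,E)$ be a tree. For $m\in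 V$ let $E^m$ be the set of directed edges obtained by orienting all edges of $T$ away from $m$, and for $i\in V$ let $\mathrm{ph}(mi)\subset E^m$ be the set of directed edges on the unique path from $m$ to $i$ (empty if $i=m$; empty products are $1$). **(a)** Let $Y$ be a multivariate Pareto distribution that is an extremal graphical model on $T$. Then for every $i\in V$ the extremal function $W^i$ of $Y$ relative to $i$ exists and is unique in law. Moreover, for every $m\in V$, if $\{W_e:e\in E^m\}$ are independent random variables such that, for each $e=(i,j)\in E^m$, $W_e$ has the law of $W^i_j$, and if $P$ is standard Pareto and independent of $\{W_e:e\in E^m\}$, then $$(Y^m_i)_{i\in V}\overset{d}{=}\Big(P\prod_{e\in\mathrm{ph}(mi)}W_e\Big)_{i\in V}.$$ **(b)** Conversely, let $\{W_{(i,j)},W_{(j,i)}:\{i,j\}\in E\}$ be independent, almost surely non-negative random variables such that for every $\{i,j\}\in E$, in both orders, $$\mathbb P(W_{(j,i)}\le z,\ W_{(j,i)}>0)=\mathbb E\big(\mathbf 1\{1/W_{(i,j)}\le z\}\,W_{(i,j)}\big),\qquad z>0.$$ For $m\in V$ put $W^m=\big(\prod_{e\in\mathrm{ph}(mi)}W_e\big)_{i\in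 V}$ and let $P$ be standard Pareto and independent of these variables. Then the vectors $P\,W^m$ are consistent: for all $m,m'\in V$ and all Borel $A\subset\mathcal L^m\cap\mathcal L^{m'}$, $\mathbb P(P\,W^m\in A)=\mathbb P(P\,W^{m'}\in A)$. Furthermore there is exactly one (in law) multivariate Pareto distribution $Y$ on $V$ whose extremal function relative to $m$ is $W^m$ for every $m\in V$, and this $Y$ is an extremal graphical model on $T$. -/

import Mathlib

open MeasureTheory ProbabilityTheory
open scoped ENNReal

noncomputable section

namespace ExtremalTree

/-! ### Multivariate Pareto distributions -/

/-- The set `𝓛 = {x ≥ 0 : ‖x‖_∞ > 1}` on which multivariate Pareto distributions live. -/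
def paretoSupport (V : Type*) : Set (V → ℝ) :=
  {x | (∀ i, 0 ≤ x i) ∧ ∃ i, 1 < x i}

/-- The set `𝓛ᵐ = {x ∈ 𝓛 : x_m > 1}`. -/
def paretoSupportAt {V : Type*} (m : V) : Set (V → ℝ) :=
  {x | x ∈ paretoSupport V ∧ 1 < x m}

/-- `μ` is (the law of) a multivariate Pareto distribution with index set `V`, on the normalized
marginal scale: a probability measure concentrated on `𝓛`, homogeneous of order `-1`, whose
margins all have the same probability of exceeding the threshold `1` (this probability is
`1 / ℓ(1, …, 1)` in terms of the stable tail dependence function `ℓ`). -/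
structure IsMultivariatePareto {V : Type*} (μ : Measure (V → ℝ)) : Prop where
  isProbabilityMeasure : IsProbabilityMeasure μ
  ae_mem_support : ∀ᵐ x ∂μ, x ∈ paretoSupport V
  homogeneous : ∀ t : ℝ, 1 ≤ t → ∀ A : Set (V → ℝ), MeasurableSet A → A ⊆ paretoSupport V →
    μ ((fun x => t • x) '' A) = (ENNReal.ofReal t)⁻¹ * μ A
  margins : ∀ i j : V, μ {x | 1 < x i} = μ {x | 1 < x j}

/-- The law of `Yᵐ`, that is, of `Y` conditioned on `{Y_m > 1}`, where `Y` has law `μ`. -/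
def exceedanceLaw {V : Type*} (μ : Measure (V → ℝ)) (m : V) : Measure (V → ℝ) :=
  cond μ {x | 1 < x m}

/-- The standard Pareto distribution, `ℙ(P ≤ x) = 1 - 1 / x` for `x ≥ 1`. -/
def stdPareto : Measure ℝ := paretoMeasure 1 1

/-- The law of `P • W`, where `P` is standard Pareto, `W` has law `ν`, and `P`, `W` are
independent. -/
def paretoMixture {V : Type*} (ν : Measure (V → ℝ)) : Measure (V → ℝ) :=
  (stdPareto.prod ν).map (fun q => q.1 • q.2)

/-- `ν` is the law of the extremal function `Wᵐ` of `Y ∼ μ` relative to coordinate `m`: a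
non-negative random vector with `Wᵐ_m = 1` almost surely and `Yᵐ = P Wᵐ` in distribution, with
`P` standard Pareto and independent of `Wᵐ`. -/
structure IsExtremalFunction {V : Type*} (μ : Measure (V → ℝ)) (m : V)
    (ν : Measure (V → ℝ)) : Prop where
  isProbabilityMeasure : IsProbabilityMeasure ν
  ae_nonneg : ∀ᵐ w ∂ν, ∀ i, 0 ≤ w i
  ae_eq_one : ∀ᵐ w ∂ν, w m = 1
  exceedanceLaw_eq : exceedanceLaw μ m = paretoMixture ν

/-! ### Extremal conditional independence and extremal graphical models -/

instance {V : Type*} (μ : Measure (V → ℝ)) (m : V) : IsFiniteMeasure (exceedanceLaw μ m) := by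
  unfold exceedanceLaw
  infer_instance

/-- Extremal conditional independence `Y_A ⊥ₑ Y_C | Y_B` for `Y ∼ μ`: for every `m`, the
subvectors `Yᵐ_A` and `Yᵐ_C` are conditionally independent given `Yᵐ_B`. -/
def ExtremalCondIndep {V : Type*} [Fintype V] (μ : Measure (V → ℝ)) (A B C : Set V) : Prop :=
  ∀ m : V, CondIndepFun
    (MeasurableSpace.comap (fun (y : V → ℝ) (b : B) => y b) inferInstance)
    (Measurable.comap_le (by fun_prop))
    (fun (y : V → ℝ) (a : A) => y a) (fun (y : V → ℝ) (c : C) => y c) (exceedanceLaw μ m)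

/-- `B` separates `A` from `C` in `G`: every path from `A` to `C` meets `B`. -/
def Separates {V : Type*} (G : SimpleGraph V) (A B C : Set V) : Prop :=
  ∀ a ∈ A, ∀ c ∈ C, ∀ p : G.Walk a c, p.IsPath → ∃ b ∈ B, b ∈ p.support

/-- The extremal global Markov property of `Y ∼ μ` on `G`. -/
def IsExtremalGraphicalModel {V : Type*} [Fintype V] (G : SimpleGraph V)
    (μ : Measure (V → ℝ)) : Prop :=
  ∀ A B C : Set V, Disjoint A B → Disjoint B C → Disjoint A C →
    Separates G A B C → ExtremalCondIndep μ A B C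

/-! ### Trees -/

/-- The edge set `Eᵐ` of the directed tree `Tᵐ`: the orientations of the edges of `T` that point
away from the root `m`. -/
def outwardEdges {V : Type*} (T : SimpleGraph V) (m : V) : Set T.Dart :=
  {e | T.dist m e.snd = T.dist m e.fst + 1}

/-- The unique path from `v` to `w` in the tree `T`. -/
def treePath {V : Type*} {T : SimpleGraph V} (hT : T.IsTree) (v w : V) : T.Walk v w :=
  (hT.existsUnique_path v w).choose

/-- The vector with entries `∏_{e ∈ ph(mi)} W_e`, the product over the directed edges of the path
from `m` to `i` (the empty product for `i = m` is `1`). -/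
def pathProduct {V Ω : Type*} {T : SimpleGraph V} (hT : T.IsTree) (W : T.Dart → Ω → ℝ) (m : V)
    (ω : Ω) (i : V) : ℝ :=
  ((treePath hT m i).darts.map (fun e => W e ω)).prod

/-- Bivariate duality between `U = W^i_j` and `U' = W^j_i`:
`ℙ(U' ≤ z, U' > 0) = 𝔼(1{1 / U ≤ z} U)` for all `z > 0`. -/
def BivariateDuality {Ω : Type*} [MeasurableSpace Ω] (Q : Measure Ω) (U U' : Ω → ℝ) : Prop :=
  ∀ z : ℝ, 0 < z →
    Q {ω | U' ω ≤ z ∧ 0 < U' ω} = ∫⁻ ω in {ω | 1 / U ω ≤ z}, ENNReal.ofReal (U ω) ∂Q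

end ExtremalTree

end

/-!
A multivariate Pareto law is the conditioning to `𝓛` of an exponent measure `Λ`, homogeneous of
order `-1`, and `Yᵐ` has law `Λ|{x m > 1}`; the extremal functions are the laws of the profiles
`x / x m` under these restrictions.

For (a), let `(i, j)` be an edge pointing away from `m`. Conditional independence of `x m` and `x j`
given `x i` together with homogeneity shows that the law of `x j` given `x i` is the same under
`Λ|{x i > 1}` and, wherever `x i > 0`, under `Λ|{x m > 1}`, namely multiplication by an independent
copy of `W^i_j`. The same two properties force `x j = 0` wherever `x i = 0`. Hence `Yᵐ` is a Markov
chain on the tree with multiplicative transitions, and such a chain is determined by its root and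
its transitions.

For (b), let the root value have the infinite density `r⁻²` on `(0, ∞)` instead of the Pareto
density. Duality says that the pair at the two ends of an edge then has, on the set where both are
positive, the same law whichever end is taken as the root. Therefore the measures obtained from two
roots `m`, `m'` agree on `{x m > 0, x m' > 0}`, first for neighbours and then along paths, and they
glue to one exponent measure.
-/

namespace ExtremalTree

section CondDistrib

variable {Ω α γ : Type*} {mΩ : MeasurableSpace Ω} {mα : MeasurableSpace α}
  {mγ : MeasurableSpace γ} {μ : Measure Ω} [SFinite μ] {X : Ω → α} {Z : Ω → γ}

theorem hasCondDistrib_congr {κ κ' : Kernel γ α} [IsSFiniteKernel κ] [IsSFiniteKernel κ']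
    (h : HasCondDistrib X Z κ μ) (hκ : ∀ᵐ ω ∂μ, κ (Z ω) = κ' (Z ω)) : HasCondDistrib X Z κ' μ := by
  have hZ := h.aemeasurable_fst
  refine ⟨h.aemeasurable, h.map_eq.trans (Measure.ext fun s hs => ?_)⟩
  rw [Measure.compProd_apply hs, Measure.compProd_apply hs,
    lintegral_map' (Kernel.measurable_kernel_prodMk_left hs).aemeasurable hZ,
    lintegral_map' (Kernel.measurable_kernel_prodMk_left hs).aemeasurable hZ]
  refine lintegral_congr_ae ?_
  filter_upwards [hκ] with ω hω using DFunLike.congr_fun hω _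

theorem hasCondDistrib_smul_measure {κ : Kernel γ α} [IsSFiniteKernel κ]
    (h : HasCondDistrib X Z κ μ) (c : ℝ≥0∞) : HasCondDistrib X Z κ (c • μ) where
  aemeasurable := h.aemeasurable.smul_measure c
  map_eq := by rw [Measure.map_smul, Measure.map_smul, h.map_eq, Measure.compProd_smul_left]

theorem restrict_compProd_prod_univ {ρ : Measure γ} [SFinite ρ] {κ : Kernel γ α}
    [IsSFiniteKernel κ] {B : Set γ} (hB : MeasurableSet B) :
    (ρ ⊗ₘ κ).restrict (B ×ˢ Set.univ) = ρ.restrict B ⊗ₘ κ := by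
  ext s hs
  have hslice (z : γ) : κ z (Prod.mk z ⁻¹' (s ∩ B ×ˢ Set.univ)) =
      B.indicator (fun z => κ z (Prod.mk z ⁻¹' s)) z := by
    by_cases hz : z ∈ B <;> simp [hz, Set.preimage_inter]
  rw [Measure.restrict_apply hs, Measure.compProd_apply (hs.inter (hB.prod .univ)),
    Measure.compProd_apply hs, ← lintegral_indicator hB]
  exact lintegral_congr hslice

theorem hasCondDistrib_restrict_preimage_iff {κ : Kernel γ α} [IsSFiniteKernel κ]
    (hX : Measurable X) (hZ : Measurable Z) {B : Set γ} (hB : MeasurableSet B) :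
    HasCondDistrib X Z κ (μ.restrict (Z ⁻¹' B)) ↔
      (μ.map fun ω => (Z ω, X ω)).restrict (B ×ˢ Set.univ) =
        (μ.map Z ⊗ₘ κ).restrict (B ×ˢ Set.univ) := by
  have hpre : (fun ω => (Z ω, X ω)) ⁻¹' B ×ˢ Set.univ = Z ⁻¹' B := by
    ext ω
    exact and_iff_left trivial
  rw [restrict_compProd_prod_univ hB, Measure.restrict_map (by fun_prop) (hB.prod .univ), hpre,
    Measure.restrict_map hZ hB]
  exact ⟨fun h => h.map_eq, fun h => ⟨by fun_prop, h⟩⟩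

theorem hasCondDistrib_restrict_preimage {κ : Kernel γ α} [IsSFiniteKernel κ]
    (h : HasCondDistrib X Z κ μ) (hX : Measurable X) (hZ : Measurable Z) {B : Set γ}
    (hB : MeasurableSet B) : HasCondDistrib X Z κ (μ.restrict (Z ⁻¹' B)) :=
  (hasCondDistrib_restrict_preimage_iff hX hZ hB).2 (congrArg _ h.map_eq)

theorem hasCondDistrib_of_forall_restrict_preimage {ι : Type*} [Countable ι] {κ : Kernel γ α}
    [IsSFiniteKernel κ] (hX : Measurable X) (hZ : Measurable Z) {B : ι → Set γ}
    (hB : ∀ i, MeasurableSet (B i)) (hB_univ : ⋃ i, B i = Set.univ)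
    (h : ∀ i, HasCondDistrib X Z κ (μ.restrict (Z ⁻¹' B i))) : HasCondDistrib X Z κ μ := by
  refine ⟨by fun_prop, ?_⟩
  rw [← Measure.restrict_univ (μ := μ.map _), ← Measure.restrict_univ (μ := μ.map Z ⊗ₘ κ),
    ← Set.univ_prod_univ, ← hB_univ, Set.iUnion_prod_const, Measure.restrict_iUnion_congr]
  exact fun i => (hasCondDistrib_restrict_preimage_iff hX hZ (hB i)).1 (h i)

end CondDistrib

section CondIndep

variable {Ω α β γ δ α' β' γ' : Type*} {mΩ : MeasurableSpace Ω} {mα : MeasurableSpace α}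
  {mβ : MeasurableSpace β} {mγ : MeasurableSpace γ} {mδ : MeasurableSpace δ}
  {mα' : MeasurableSpace α'} {mβ' : MeasurableSpace β'} {mγ' : MeasurableSpace γ'}
  {μ : Measure Ω} [IsFiniteMeasure μ] {X : Ω → α} {Y : Ω → β} {Z : Ω → γ} [StandardBorelSpace Ω]
  [StandardBorelSpace α] [Nonempty α] [StandardBorelSpace β] [Nonempty β]

theorem hasCondDistrib_prodMk_of_condIndepFun (hY : Measurable Y) (hZ : Measurable Z)
    {κ : Kernel γ α} [IsFiniteKernel κ] (hX : Measurable X) (hκ : HasCondDistrib X Z κ μ)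
    (h : Y ⟂ᵢ[Z, hZ; μ] X) : HasCondDistrib X (fun ω => (Z ω, Y ω)) (κ.prodMkRight β) μ := by
  refine ⟨by fun_prop, ?_⟩
  rw [← condDistrib_ae_eq_iff_measure_eq_compProd _ hX.aemeasurable]
  refine ((condIndepFun_iff_condDistrib_prod_ae_eq_prodMkRight hX hY hZ).1 h).trans ?_
  have hae := condDistrib_ae_eq_of_measure_eq_compProd Z hX.aemeasurable hκ.map_eq
  rw [← Measure.fst_map_prodMk hY] at hae
  exact ae_of_ae_map measurable_fst.aemeasurable hae

theorem condIndepFun_iff_exists_hasCondDistrib (hX : Measurable X) (hY : Measurable Y)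
    (hZ : Measurable Z) :
    Y ⟂ᵢ[Z, hZ; μ] X ↔ ∃ κ : Kernel γ α, IsMarkovKernel κ ∧
      HasCondDistrib X (fun ω => (Z ω, Y ω)) (κ.prodMkRight β) μ := by
  have hcond : HasCondDistrib X Z (condDistrib X Z μ) μ :=
    ⟨by fun_prop, (compProd_map_condDistrib hX.aemeasurable).symm⟩
  refine ⟨fun h => ⟨condDistrib X Z μ, inferInstance,
    hasCondDistrib_prodMk_of_condIndepFun hY hZ hX hcond h⟩, ?_⟩
  rintro ⟨κ, _, hκ⟩
  have hκZ : HasCondDistrib X Z κ μ := hκ.comp_right (hf := measurable_fst)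
  have hae := condDistrib_ae_eq_of_measure_eq_compProd Z hX.aemeasurable hκZ.map_eq
  rw [← Measure.fst_map_prodMk hY] at hae
  rw [condIndepFun_iff_condDistrib_prod_ae_eq_prodMkRight hX hY hZ]
  filter_upwards [condDistrib_ae_eq_of_measure_eq_compProd _ hX.aemeasurable hκ.map_eq,
    ae_of_ae_map measurable_fst.aemeasurable hae] with p h₁ h₂
  rw [h₁, Kernel.prodMkRight_apply, Kernel.prodMkRight_apply, h₂]

theorem condIndepFun_comp_prodMk [StandardBorelSpace α'] [Nonempty α'] [StandardBorelSpace β']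
    [Nonempty β'] (hX : Measurable X) (hY : Measurable Y) (hZ : Measurable Z)
    (h : Y ⟂ᵢ[Z, hZ; μ] X) {f : α → α'} (hf : Measurable f) {g : γ × β → β'} (hg : Measurable g)
    {k : γ × β → γ'} (hk : Measurable k) {l : γ' → γ} (hl : Measurable l)
    (hlk : ∀ ω, l (k (Z ω, Y ω)) = Z ω) :
    (fun ω => g (Z ω, Y ω)) ⟂ᵢ[fun ω => k (Z ω, Y ω), hk.comp (hZ.prodMk hY); μ]
      fun ω => f (X ω) := by
  obtain ⟨κ, _, hκ⟩ := (condIndepFun_iff_exists_hasCondDistrib hX hY hZ).1 h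
  have := Kernel.IsMarkovKernel.map κ hf
  have hκl : HasCondDistrib (f ∘ X) (fun ω => (Z ω, Y ω))
      ((((κ.map f).comap l hl).prodMkRight β').comap (fun p => (k p, g p)) (hk.prodMk hg)) μ :=
    hasCondDistrib_congr (hκ.comp_left hf) <| .of_forall fun ω => by
      simp only [Kernel.map_apply _ hf, Kernel.prodMkRight_apply, Kernel.comap_apply, hlk]
  exact (condIndepFun_iff_exists_hasCondDistrib (hf.comp hX) (hg.comp (hZ.prodMk hY))
    (hk.comp (hZ.prodMk hY))).2 ⟨(κ.map f).comap l hl, inferInstance, hκl.comp_right⟩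

theorem condIndepFun_prodMk_of_condIndepFun [StandardBorelSpace δ] [Nonempty δ] {W : Ω → δ}
    (hX : Measurable X) (hY : Measurable Y) (hZ : Measurable Z) (hW : Measurable W)
    (hYX : Y ⟂ᵢ[Z, hZ; μ] X) (hWX : W ⟂ᵢ[fun ω => (Z ω, Y ω), hZ.prodMk hY; μ] X) :
    (fun ω => (Y ω, W ω)) ⟂ᵢ[Z, hZ; μ] X := by
  obtain ⟨κ, _, hκ⟩ := (condIndepFun_iff_exists_hasCondDistrib hX hY hZ).1 hYX
  refine (condIndepFun_iff_exists_hasCondDistrib hX (hY.prodMk hW) hZ).2 ⟨κ, inferInstance, ?_⟩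
  exact (hasCondDistrib_prodMk_of_condIndepFun hW (hZ.prodMk hY) hX hκ
    hWX).measurableEquiv_comp_right MeasurableEquiv.prodAssoc

theorem measure_fiber_inter_mul_of_condIndepFun [MeasurableSingletonClass γ] (hX : Measurable X)
    (hY : Measurable Y) (hZ : Measurable Z) (h : Y ⟂ᵢ[Z, hZ; μ] X) (z : γ) {A : Set β}
    (hA : MeasurableSet A) {B : Set α} (hB : MeasurableSet B) :
    μ (Z ⁻¹' {z} ∩ Y ⁻¹' A ∩ X ⁻¹' B) * μ (Z ⁻¹' {z}) =
      μ (Z ⁻¹' {z} ∩ Y ⁻¹' A) * μ (Z ⁻¹' {z} ∩ X ⁻¹' B) := by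
  obtain ⟨κ, _, hκ⟩ := (condIndepFun_iff_exists_hasCondDistrib hX hY hZ).1 h
  have hfactor {D : Set β} (hD : MeasurableSet D) :
      μ (Z ⁻¹' {z} ∩ Y ⁻¹' D ∩ X ⁻¹' B) = μ (Z ⁻¹' {z} ∩ Y ⁻¹' D) * κ z B := by
    have hzD : MeasurableSet ({z} ×ˢ D : Set (γ × β)) := (measurableSet_singleton z).prod hD
    have := congrArg (fun ρ => ρ (({z} ×ˢ D) ×ˢ B)) hκ.map_eq
    rw [Measure.map_apply (by fun_prop) (hzD.prod hB), Measure.compProd_apply_prod hzD hB,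
      setLIntegral_congr_fun hzD (g := fun _ => κ z B) (fun p hp => by
        rw [Kernel.prodMkRight_apply, hp.1]), setLIntegral_const,
      Measure.map_apply (by fun_prop) hzD, mul_comm] at this
    exact this
  have hfiber := hfactor .univ
  rw [Set.preimage_univ, Set.inter_univ] at hfiber
  rw [hfactor hA, hfiber, mul_right_comm, mul_assoc]

end CondIndep

section Tree

variable {V : Type*} {T : SimpleGraph V}

theorem treePath_isPath (hT : T.IsTree) (v w : V) : (treePath hT v w).IsPath :=
  (hT.existsUnique_path v w).choose_spec.1

theorem eq_treePath (hT : T.IsTree) {v w : V} {p : T.Walk v w} (hp : p.IsPath) :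
    p = treePath hT v w :=
  (hT.existsUnique_path v w).choose_spec.2 p hp

theorem length_treePath (hT : T.IsTree) (v w : V) : (treePath hT v w).length = T.dist v w := by
  obtain ⟨p, hp⟩ := hT.connected.exists_walk_length_eq_dist v w
  rw [← eq_treePath hT (p.isPath_of_length_eq_dist hp), hp]

theorem treePath_self (hT : T.IsTree) (v : V) : treePath hT v v = .nil :=
  (eq_treePath hT SimpleGraph.Walk.IsPath.nil).symm

theorem treePath_snd (hT : T.IsTree) {m : V} {e : T.Dart} (he : e ∈ outwardEdges T m) :
    treePath hT m e.snd = (treePath hT m e.fst).concat e.adj := by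
  refine (eq_treePath hT (SimpleGraph.Walk.isPath_of_length_eq_dist _ ?_)).symm
  rw [SimpleGraph.Walk.length_concat, length_treePath]
  exact he.symm

theorem treePath_eq_cons (hT : T.IsTree) {m m' v : V} (h : T.Adj m m')
    (hv : T.dist m v = T.dist m' v + 1) : treePath hT m v = .cons h (treePath hT m' v) := by
  refine (eq_treePath hT (SimpleGraph.Walk.isPath_of_length_eq_dist _ ?_)).symm
  rw [SimpleGraph.Walk.length_cons, length_treePath, hv]

theorem dist_eq_dist_add_one_or (hT : T.IsTree) {m m' : V} (h : T.Adj m m') (v : V) :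
    T.dist m v = T.dist m' v + 1 ∨ T.dist m' v = T.dist m v + 1 := by
  simpa only [SimpleGraph.dist_comm (u := v)] using hT.dist_eq_dist_add_one_of_adj v h

theorem exists_outwardEdge_snd_eq (hT : T.IsTree) {m v : V} (hv : v ≠ m) :
    ∃ e ∈ outwardEdges T m, e.snd = v := by
  obtain ⟨p, hp⟩ := hT.connected.exists_walk_length_eq_dist v m
  cases p with
  | nil => exact absurd rfl hv
  | @cons _ u _ h q =>
    refine ⟨⟨(u, v), h.symm⟩, ?_, rfl⟩
    have hq : T.dist u m ≤ q.length := SimpleGraph.dist_le q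
    have huv := dist_eq_dist_add_one_or hT h m
    rw [SimpleGraph.Walk.length_cons] at hp
    change T.dist m v = T.dist m u + 1
    simp only [SimpleGraph.dist_comm (u := m)]
    omega

theorem outward_induction (hT : T.IsTree) {m : V} {motive : V → Prop} (root : motive m)
    (step : ∀ e ∈ outwardEdges T m, motive e.fst → motive e.snd) (v : V) : motive v := by
  induction hn : T.dist m v using Nat.strong_induction_on generalizing v with
  | _ n ih =>
    obtain rfl | hv := eq_or_ne v m
    · exact root
    · obtain ⟨e, he, rfl⟩ := exists_outwardEdge_snd_eq hT hv
      have hdist : T.dist m e.snd = T.dist m e.fst + 1 := he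
      exact step e he (ih _ (by omega) _ rfl)

/-- A connected set of vertices containing `m`, encoded as a set that contains the root `m` and is
closed under taking parents in the tree rooted at `m`. -/
structure IsRootedSubtree (T : SimpleGraph V) (m : V) (S : Set V) : Prop where
  root_mem : m ∈ S
  fst_mem : ∀ e ∈ outwardEdges T m, e.snd ∈ S → e.fst ∈ S

theorem IsRootedSubtree.univ (T : SimpleGraph V) (m : V) : IsRootedSubtree T m Set.univ :=
  ⟨trivial, fun _ _ _ => trivial⟩

-- A vertex of `S` at maximal distance from the root is nobody's parent and can be removed.
theorem IsRootedSubtree.exists_eq_insert (hT : T.IsTree) {m : V} {S : Set V} (hfin : S.Finite)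
    (hS : IsRootedSubtree T m S) (hne : S ≠ {m}) :
    ∃ S', IsRootedSubtree T m S' ∧ ∃ e ∈ outwardEdges T m, e.fst ∈ S' ∧ e.snd ∉ S' ∧
      S = insert e.snd S' := by
  have hne' : (S \ {m}).Nonempty := Set.nonempty_of_not_subset fun h =>
    hne (h.antisymm (Set.singleton_subset_iff.2 hS.root_mem))
  obtain ⟨j, ⟨hjS, hjm⟩, hfar⟩ := Set.exists_max_image _ (T.dist m) hfin.sdiff hne'
  obtain ⟨e, he, rfl⟩ := exists_outwardEdge_snd_eq hT hjm
  refine ⟨S \ {e.snd}, ⟨⟨hS.root_mem, fun h => hjm h.symm⟩, fun d hd hdS =>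
    ⟨hS.fst_mem d hd hdS.1, fun hde => ?_⟩⟩, e, he, ⟨hS.fst_mem e he hjS, e.adj.ne⟩,
    fun h => h.2 rfl, by simp [hjS]⟩
  have hdist : T.dist m d.snd = T.dist m d.fst + 1 := hd
  have hdm : d.snd ≠ m := fun h => by simp [h] at hdist
  have hle := hfar d.snd ⟨hdS.1, hdm⟩
  rw [Set.mem_singleton_iff.1 hde] at hdist
  omega

theorem IsRootedSubtree.induction [Finite V] (hT : T.IsTree) {m : V} {motive : Set V → Prop}
    (root : motive {m})
    (step : ∀ S, IsRootedSubtree T m S → ∀ e ∈ outwardEdges T m, e.fst ∈ S → e.snd ∉ S →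
      motive S → motive (insert e.snd S)) {S : Set V} (hS : IsRootedSubtree T m S) :
    motive S := by
  induction hn : S.ncard using Nat.strong_induction_on generalizing S with
  | _ n ih =>
    obtain rfl | hne := eq_or_ne S {m}
    · exact root
    · obtain ⟨S', hS', e, he, hfst, hsnd, rfl⟩ := hS.exists_eq_insert hT S.toFinite hne
      refine step S' hS' e he hfst hsnd (ih _ ?_ hS' rfl)
      rw [← hn, Set.ncard_insert_of_notMem hsnd]
      exact Nat.lt_succ_self _

theorem IsRootedSubtree.mem_of_mem_support (hT : T.IsTree) {m : V} {S : Set V}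
    (hS : IsRootedSubtree T m S) {v : V} (hv : v ∈ S) {u : V}
    (hu : u ∈ (treePath hT m v).support) : u ∈ S := by
  induction v using outward_induction hT (m := m) with
  | root =>
    simp only [treePath_self, SimpleGraph.Walk.support_nil, List.mem_singleton] at hu
    exact hu ▸ hv
  | step e he ih =>
    rw [treePath_snd hT he, SimpleGraph.Walk.support_concat, List.mem_append,
      List.mem_singleton] at hu
    rcases hu with hu | rfl
    · exact ih (hS.fst_mem e he hv) hu
    · exact hv

theorem mem_outwardEdges_of_mem_darts (hT : T.IsTree) {m v : V} {d : T.Dart}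
    (hd : d ∈ (treePath hT m v).darts) : d ∈ outwardEdges T m := by
  induction v using outward_induction hT (m := m) with
  | root => simp [treePath_self] at hd
  | step e he ih =>
    rw [treePath_snd hT he, SimpleGraph.Walk.darts_concat, List.concat_eq_append,
      List.mem_append, List.mem_singleton] at hd
    rcases hd with hd | rfl
    · exact ih hd
    · exact he

-- Otherwise `e` followed by the path `p` would be the tree path from `e.fst` to `c`, which stays
-- inside `S`.
theorem IsRootedSubtree.fst_mem_support (hT : T.IsTree) {m : V} {S : Set V}
    (hS : IsRootedSubtree T m S) {e : T.Dart} (hfst : e.fst ∈ S) (hsnd : e.snd ∉ S) {c : V}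
    (hc : c ∈ S) {p : T.Walk e.snd c} (hp : p.IsPath) : e.fst ∈ p.support := by
  classical
  by_contra hn
  have hcons := eq_treePath hT (p := .cons e.adj p)
    ((SimpleGraph.Walk.cons_isPath_iff _ _).2 ⟨hp, hn⟩)
  let q := (treePath hT m e.fst).reverse.append (treePath hT m c)
  have hmem : e.snd ∈ q.support := by
    refine q.support_bypass_subset_support ?_
    rw [eq_treePath hT q.bypass_isPath, ← hcons]
    simp
  rw [SimpleGraph.Walk.mem_support_append_iff, SimpleGraph.Walk.support_reverse,
    List.mem_reverse] at hmem
  exact hsnd (hmem.elim (hS.mem_of_mem_support hT hfst) (hS.mem_of_mem_support hT hc))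

theorem notMem_darts_treePath_of_dist_eq (hT : T.IsTree) {m m' v : V} (h : T.Adj m m')
    (hv : T.dist m' v = T.dist m v + 1) {d : T.Dart} (hd : m' = d.fst ∨ m' = d.snd) :
    d ∉ (treePath hT m v).darts := by
  intro hmem
  have hp := treePath_isPath hT m' v
  rw [treePath_eq_cons hT h.symm hv, SimpleGraph.Walk.cons_isPath_iff] at hp
  rcases hd with rfl | rfl
  · exact hp.2 (SimpleGraph.Walk.dart_fst_mem_support_of_mem_darts _ hmem)
  · exact hp.2 (SimpleGraph.Walk.dart_snd_mem_support_of_mem_darts _ hmem)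

end Tree

section PathProduct

variable {V Ω Ω' : Type*} {T : SimpleGraph V} (hT : T.IsTree)

@[simp]
theorem pathProduct_self (W : T.Dart → Ω → ℝ) (m : V) (ω : Ω) : pathProduct hT W m ω m = 1 := by
  simp [pathProduct, treePath_self]

theorem pathProduct_snd (W : T.Dart → Ω → ℝ) {m : V} {e : T.Dart} (he : e ∈ outwardEdges T m)
    (ω : Ω) : pathProduct hT W m ω e.snd = pathProduct hT W m ω e.fst * W e ω := by
  simp [pathProduct, treePath_snd hT he]

theorem pathProduct_eq_mul (W : T.Dart → Ω → ℝ) {m m' v : V} (h : T.Adj m m')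
    (hv : T.dist m v = T.dist m' v + 1) (ω : Ω) :
    pathProduct hT W m ω v = W ⟨(m, m'), h⟩ ω * pathProduct hT W m' ω v := by
  simp [pathProduct, treePath_eq_cons hT h hv]

theorem pathProduct_congr {W : T.Dart → Ω → ℝ} {W' : T.Dart → Ω' → ℝ} {ω : Ω} {ω' : Ω'} {m v : V}
    (h : ∀ d ∈ (treePath hT m v).darts, W d ω = W' d ω') :
    pathProduct hT W m ω v = pathProduct hT W' m ω' v :=
  congrArg List.prod (List.map_congr_left h)

theorem pathProduct_nonneg {W : T.Dart → Ω → ℝ} {ω : Ω} (h : ∀ d, 0 ≤ W d ω) (m v : V) :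
    0 ≤ pathProduct hT W m ω v :=
  List.prod_nonneg (by simpa using fun d _ => h d)

theorem measurable_pathProduct [MeasurableSpace Ω] {W : T.Dart → Ω → ℝ}
    (hW : ∀ d, Measurable (W d)) (m : V) : Measurable (pathProduct hT W m) := by
  refine measurable_pi_lambda _ fun v => ?_
  unfold pathProduct
  induction (treePath hT m v).darts with
  | nil => exact measurable_const
  | cons d l ih =>
    simp only [List.map_cons, List.prod_cons]
    exact (hW d).mul ih

end PathProduct

section PowerMeasure

open Set

instance : IsProbabilityMeasure stdPareto :=
  isProbabilityMeasure_paretoMeasure one_pos one_pos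

theorem stdPareto_Ioi {t : ℝ} (ht : 1 ≤ t) : stdPareto (Ioi t) = (ENNReal.ofReal t)⁻¹ := by
  have ht0 : 0 < t := one_pos.trans_le ht
  have hintegral : ∫ x in Ioi t, x ^ (-2 : ℝ) = t⁻¹ := by
    rw [integral_Ioi_rpow_of_lt (by norm_num) ht0]
    norm_num [Real.rpow_neg_one]
  calc stdPareto (Ioi t) = ∫⁻ x in Ioi t, ENNReal.ofReal (x ^ (-2 : ℝ)) := by
        rw [stdPareto, paretoMeasure, withDensity_apply _ measurableSet_Ioi]
        refine setLIntegral_congr_fun measurableSet_Ioi fun x hx => ?_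
        rw [paretoPDF_of_le (ht.trans (le_of_lt hx))]
        norm_num
    _ = ENNReal.ofReal t⁻¹ := by
        rw [← hintegral, ofReal_integral_eq_lintegral_ofReal
          (integrableOn_Ioi_rpow_of_lt (by norm_num) ht0)]
        exact ae_restrict_of_forall_mem measurableSet_Ioi fun x hx =>
          Real.rpow_nonneg (ht0.trans hx).le _
    _ = (ENNReal.ofReal t)⁻¹ := ENNReal.ofReal_inv_of_pos ht0

theorem eq_smul_stdPareto {ρ : Measure ℝ} [IsFiniteMeasure ρ]
    (hρ : ∀ t, 1 ≤ t → ρ (Ioi t) = (ENNReal.ofReal t)⁻¹ * ρ univ) : ρ = ρ univ • stdPareto := by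
  refine ext_of_generate_finite _ (borel_eq_generateFrom_Ioi ℝ ▸ BorelSpace.measurable_eq)
    isPiSystem_Ioi ?_ (by simp)
  rintro _ ⟨t, rfl⟩
  have eq_of_one_le {t : ℝ} (ht : 1 ≤ t) : ρ (Ioi t) = (ρ univ • stdPareto) (Ioi t) := by
    rw [hρ t ht, Measure.smul_apply, stdPareto_Ioi ht, smul_eq_mul, mul_comm]
  obtain ht | ht := le_total 1 t
  · exact eq_of_one_le ht
  · have full {ρ' : Measure ℝ} (h : ρ' (Ioi 1) = ρ' univ) : ρ' (Ioi t) = ρ' univ :=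
      le_antisymm (measure_mono (subset_univ _)) (h ▸ measure_mono (Ioi_subset_Ioi ht))
    rw [full (by simp [hρ 1 le_rfl]), full]
    · simp
    · simp [stdPareto_Ioi le_rfl]

/-- The measure on `(0, ∞)` with density `r⁻²`, which gives mass `1 / t` to `(t, ∞)`, encoded as
the image of Lebesgue measure under inversion. It is the radial part of an exponent measure. -/
noncomputable def powerMeasure : Measure ℝ :=
  (volume.restrict (Ioi 0)).map (·⁻¹)

theorem ae_powerMeasure_pos : ∀ᵐ r ∂powerMeasure, 0 < r := by
  rw [powerMeasure, ae_map_iff (by fun_prop) measurableSet_Ioi]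
  filter_upwards [ae_restrict_mem measurableSet_Ioi] with r hr using inv_pos.2 hr

theorem powerMeasure_Ioi {t : ℝ} (ht : 0 < t) : powerMeasure (Ioi t) = (ENNReal.ofReal t)⁻¹ := by
  have hpre : (·⁻¹) ⁻¹' Ioi t ∩ Ioi 0 = Ioo 0 t⁻¹ := by
    ext r
    simp only [mem_inter_iff, mem_preimage, mem_Ioi, mem_Ioo]
    rw [and_comm]
    exact and_congr_right fun hr => lt_inv_comm₀ ht hr
  rw [powerMeasure, Measure.map_apply (by fun_prop) measurableSet_Ioi,
    Measure.restrict_apply (measurable_inv measurableSet_Ioi), hpre, Real.volume_Ioo, sub_zero,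
    ENNReal.ofReal_inv_of_pos ht]

instance : SigmaFinite powerMeasure :=
  (MeasurableEquiv.inv ℝ).sigmaFinite_map

theorem map_mul_left_powerMeasure {c : ℝ} (hc : 0 < c) :
    powerMeasure.map (c * ·) = ENNReal.ofReal c • powerMeasure := by
  have hlebesgue : (volume.restrict (Ioi 0)).map (c⁻¹ * ·) =
      ENNReal.ofReal c • volume.restrict (Ioi (0 : ℝ)) := by
    have hpre : (c⁻¹ * ·) ⁻¹' Ioi 0 = Ioi (0 : ℝ) := by
      ext r
      simp [hc]
    nth_rw 1 [← hpre]
    rw [← Measure.restrict_map (by fun_prop) measurableSet_Ioi,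
      Real.map_volume_mul_left (inv_ne_zero hc.ne'), Measure.restrict_smul, inv_inv, abs_of_pos hc]
  rw [powerMeasure, ← Measure.map_smul, ← hlebesgue, Measure.map_map (by fun_prop) (by fun_prop),
    Measure.map_map (by fun_prop) (by fun_prop)]
  congr 1
  ext r
  simp [mul_comm]

theorem stdPareto_eq_restrict : stdPareto = powerMeasure.restrict (Ioi 1) := by
  have huniv : powerMeasure.restrict (Ioi 1) univ = 1 := by
    simp [powerMeasure_Ioi one_pos]
  have : IsFiniteMeasure (powerMeasure.restrict (Ioi 1)) := ⟨by simp [huniv]⟩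
  rw [eq_smul_stdPareto (ρ := powerMeasure.restrict (Ioi 1)), huniv, one_smul]
  intro t ht
  rw [huniv, mul_one, Measure.restrict_apply measurableSet_Ioi,
    inter_eq_left.2 (Ioi_subset_Ioi ht), powerMeasure_Ioi (one_pos.trans_le ht)]

theorem ae_stdPareto_one_lt : ∀ᵐ r ∂stdPareto, 1 < r := by
  rw [stdPareto_eq_restrict]
  exact ae_restrict_mem measurableSet_Ioi

end PowerMeasure

section Duality

open Set

/-- The form taken by `BivariateDuality` for the laws `ν` and `ν'` of `U` and `U'`: on `(0, ∞)`,
`ν'` is the image under inversion of the size-biased version of `ν`. -/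
def LawDuality (ν ν' : Measure ℝ) : Prop :=
  ν'.restrict (Ioi 0) = (ν.withDensity ENNReal.ofReal).map (·⁻¹)

theorem BivariateDuality.lawDuality {Ω : Type*} [MeasurableSpace Ω] {Q : Measure Ω}
    [IsFiniteMeasure Q] {U U' : Ω → ℝ} (h : BivariateDuality Q U U') (hU : Measurable U)
    (hU' : Measurable U') : LawDuality (Q.map U) (Q.map U') := by
  have hinv {z : ℝ} : MeasurableSet {u : ℝ | u⁻¹ ≤ z} := measurable_inv measurableSet_Iic
  refine Measure.ext_of_Iic _ _ fun z => ?_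
  rw [Measure.restrict_apply measurableSet_Iic, Measure.map_apply (by fun_prop) measurableSet_Iic]
  change _ = (Q.map U).withDensity ENNReal.ofReal {u | u⁻¹ ≤ z}
  rw [withDensity_apply _ hinv]
  obtain hz | hz := le_or_gt z 0
  · rw [Iic_inter_Ioi, Ioc_eq_empty hz.not_gt, measure_empty]
    refine (setLIntegral_eq_zero hinv fun u hu => ?_).symm
    exact ENNReal.ofReal_of_nonpos (inv_nonpos.1 (le_trans hu hz))
  · rw [setLIntegral_map hinv (by fun_prop) hU, Measure.map_apply hU' (by measurability)]
    simp only [BivariateDuality, one_div] at h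
    exact h z hz

theorem map_prod_powerMeasure_restrict (ν : Measure ℝ) [SFinite ν] :
    (powerMeasure.prod (ν.restrict (Ioi 0))).map (fun p => (p.1, p.1 * p.2)) =
      (powerMeasure.prod ((ν.withDensity ENNReal.ofReal).map (·⁻¹))).map
        fun p => (p.1 * p.2, p.1) := by
  have hm : Measurable fun p : ℝ × ℝ => (p.1, p.1 * p.2) := by fun_prop
  have hm' : Measurable fun p : ℝ × ℝ => (p.1 * p.2, p.1) := by fun_prop
  refine Measure.ext fun A hA => ?_
  have hscale {u : ℝ} (hu : 0 < u) : powerMeasure ((fun r => (r, r * u)) ⁻¹' A) =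
      ENNReal.ofReal u * powerMeasure ((fun r => (r * u⁻¹, r)) ⁻¹' A) := by
    rw [← smul_eq_mul, ← Measure.smul_apply, ← map_mul_left_powerMeasure hu,
      Measure.map_apply (by fun_prop)
        ((by fun_prop : Measurable fun r : ℝ => (r * u⁻¹, r)) hA), ← preimage_comp]
    congr 2
    ext r
    · simp [mul_comm u, hu.ne']
    · simp [mul_comm u]
  have hmeas : Measurable fun u => powerMeasure ((fun r => (r * u⁻¹, r)) ⁻¹' A) :=
    (measurable_measure_prodMk_right (hm' hA)).comp measurable_inv
  rw [Measure.map_apply hm hA, Measure.map_apply hm' hA, Measure.prod_apply_symm (hm hA),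
    Measure.prod_apply_symm (hm' hA), lintegral_map (measurable_measure_prodMk_right (hm' hA))
      (by fun_prop)]
  refine Eq.trans ?_ (lintegral_withDensity_eq_lintegral_mul _ (by fun_prop) hmeas).symm
  rw [← lintegral_indicator measurableSet_Ioi]
  refine lintegral_congr fun u => ?_
  obtain hu | hu := lt_or_ge 0 u
  · rw [indicator_of_mem (mem_Ioi.2 hu)]
    exact hscale hu
  · simp [indicator_of_notMem (notMem_Ioi.2 hu), ENNReal.ofReal_of_nonpos hu]

theorem LawDuality.restrict_map_prod_powerMeasure {ν ν' : Measure ℝ} [SFinite ν] [SFinite ν']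
    (h : LawDuality ν ν') :
    ((powerMeasure.prod ν).map fun p => (p.1, p.1 * p.2)).restrict (Ioi 0 ×ˢ Ioi 0) =
      ((powerMeasure.prod ν').map fun p => (p.1 * p.2, p.1)).restrict (Ioi 0 ×ˢ Ioi 0) := by
  have hquad : MeasurableSet (Ioi (0 : ℝ) ×ˢ Ioi (0 : ℝ)) :=
    measurableSet_Ioi.prod measurableSet_Ioi
  have hpre : (fun p : ℝ × ℝ => (p.1, p.1 * p.2)) ⁻¹' (Ioi 0 ×ˢ Ioi 0) = Ioi 0 ×ˢ Ioi 0 := by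
    ext ⟨r, u⟩
    exact and_congr_right fun hr : 0 < r => mul_pos_iff_of_pos_left hr
  have hpre' : (fun p : ℝ × ℝ => (p.1 * p.2, p.1)) ⁻¹' (Ioi 0 ×ˢ Ioi 0) = Ioi 0 ×ˢ Ioi 0 := by
    ext ⟨r, u⟩
    exact and_comm.trans (and_congr_right fun hr : 0 < r => mul_pos_iff_of_pos_left hr)
  rw [Measure.restrict_map (by fun_prop) hquad, Measure.restrict_map (by fun_prop) hquad, hpre,
    hpre', ← Measure.prod_restrict, ← Measure.prod_restrict, h, Measure.restrict_eq_self_of_ae_mem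
      (show ∀ᵐ r ∂powerMeasure, r ∈ Ioi 0 from ae_powerMeasure_pos),
    map_prod_powerMeasure_restrict]

end Duality

section Gluing

variable {α ι : Type*} [MeasurableSpace α]

theorem restrict_inter_eq_trans {μ₁ μ₂ μ₃ : Measure α} {s₁ s₂ s₃ : Set α}
    (h₁₂ : μ₁.restrict (s₁ ∩ s₂) = μ₂.restrict (s₁ ∩ s₂))
    (h₂₃ : μ₂.restrict (s₂ ∩ s₃) = μ₃.restrict (s₂ ∩ s₃))
    (h₁ : ∀ᵐ x ∂μ₁, x ∈ s₃ → x ∈ s₂) (h₃ : ∀ᵐ x ∂μ₃, x ∈ s₁ → x ∈ s₂) :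
    μ₁.restrict (s₁ ∩ s₃) = μ₃.restrict (s₁ ∩ s₃) := by
  have hsub₁ : s₁ ∩ s₂ ∩ s₃ ⊆ s₁ ∩ s₂ := Set.inter_subset_left
  have hsub₃ : s₁ ∩ s₂ ∩ s₃ ⊆ s₂ ∩ s₃ := Set.inter_subset_inter_left _ Set.inter_subset_right
  calc μ₁.restrict (s₁ ∩ s₃) = μ₁.restrict (s₁ ∩ s₂ ∩ s₃) := by
        refine Measure.restrict_congr_set ?_
        filter_upwards [h₁] with x hx
        exact propext ⟨fun h => ⟨⟨h.1, hx h.2⟩, h.2⟩, fun h => ⟨h.1.1, h.2⟩⟩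
    _ = μ₃.restrict (s₁ ∩ s₂ ∩ s₃) :=
        (Measure.restrict_congr_mono hsub₁ h₁₂).trans (Measure.restrict_congr_mono hsub₃ h₂₃)
    _ = μ₃.restrict (s₁ ∩ s₃) := by
        refine Measure.restrict_congr_set ?_
        filter_upwards [h₃] with x hx
        exact propext ⟨fun h => ⟨h.1.1, h.2⟩, fun h => ⟨⟨h.1, hx h.1⟩, h.2⟩⟩

theorem exists_measure_restrict_eq [Countable ι] [Nonempty ι] {P : ι → Set α}
    (hP : ∀ i, MeasurableSet (P i)) {μ : ι → Measure α} (hμ : ∀ i, ∀ᵐ x ∂μ i, x ∈ P i)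
    (hcomp : ∀ i j, (μ i).restrict (P i ∩ P j) = (μ j).restrict (P i ∩ P j)) :
    ∃ M : Measure α, (∀ i, M.restrict (P i) = μ i) ∧ ∀ᵐ x ∂M, x ∈ ⋃ i, P i := by
  obtain ⟨f, hf⟩ := exists_surjective_nat ι
  let D : ℕ → Set α := disjointed (P ∘ f)
  have hD (n : ℕ) : MeasurableSet (D n) := .disjointed (fun n => hP (f n)) n
  have hDP (n : ℕ) : D n ⊆ P (f n) := disjointed_subset _ n
  have hDU : ⋃ n, D n = ⋃ i, P i := (iUnion_disjointed).trans (hf.iUnion_comp P)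
  refine ⟨Measure.sum fun n => (μ (f n)).restrict (D n), fun i => ?_, ?_⟩
  · have hpiece (n : ℕ) : ((μ (f n)).restrict (D n)).restrict (P i) = (μ i).restrict (D n) := by
      rw [Measure.restrict_restrict (hP i), ← Set.inter_comm,
        Measure.restrict_congr_mono (Set.inter_subset_inter_left _ (hDP n)) (hcomp (f n) i),
        ← Measure.restrict_restrict (hD n), Measure.restrict_eq_self_of_ae_mem (hμ i)]
    rw [Measure.restrict_sum _ (hP i), funext hpiece,
      ← Measure.restrict_iUnion (disjoint_disjointed _) hD, hDU]
    exact Measure.restrict_eq_self_of_ae_mem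
      ((hμ i).mono fun x hx => Set.mem_iUnion_of_mem i hx)
  · refine (Measure.ae_sum_iff' (p := fun x => x ∈ ⋃ i, P i) (MeasurableSet.iUnion hP)).2
      fun n => ?_
    filter_upwards [ae_restrict_mem (hD n)] with x hx
    exact Set.mem_iUnion_of_mem _ (hDP n hx)

theorem measure_eq_of_restrict_eq [Countable ι] {P : ι → Set α} {μ ν : Measure α}
    (h : ∀ i, μ.restrict (P i) = ν.restrict (P i)) (hμ : ∀ᵐ x ∂μ, x ∈ ⋃ i, P i)
    (hν : ∀ᵐ x ∂ν, x ∈ ⋃ i, P i) : μ = ν := by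
  rw [← Measure.restrict_eq_self_of_ae_mem hμ, ← Measure.restrict_eq_self_of_ae_mem hν]
  exact Measure.restrict_iUnion_congr.2 h

end Gluing

section Resampling

variable {ι : Type*} [DecidableEq ι] {α : ι → Type*} [∀ i, MeasurableSpace (α i)]

theorem measurable_update_snd_fst (d : ι) :
    Measurable fun p : α d × (∀ i, α i) => Function.update p.2 d p.1 :=
  measurable_update'.comp measurable_swap

theorem map_update_prod_pi [Fintype ι] (ν : ∀ i, Measure (α i)) [∀ i, IsProbabilityMeasure (ν i)]
    (d : ι) :
    ((ν d).prod (Measure.pi ν)).map (fun p => Function.update p.2 d p.1) = Measure.pi ν := by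
  refine (Measure.pi_eq fun s hs => ?_).symm
  have hpre : (fun p : α d × (∀ i, α i) => Function.update p.2 d p.1) ⁻¹' Set.univ.pi s =
      s d ×ˢ Set.univ.pi (Function.update s d Set.univ) := by
    ext ⟨u, w⟩
    simp only [Set.mem_preimage, Set.mem_univ_pi, Set.mem_prod]
    refine ⟨fun h => ⟨by simpa using h d, fun i => ?_⟩, fun h i => ?_⟩
    · obtain rfl | hi := eq_or_ne i d
      · simp
      · simpa [hi] using h i
    · obtain rfl | hi := eq_or_ne i d
      · simpa using h.1
      · simpa [hi] using h.2 i
  rw [Measure.map_apply (measurable_update_snd_fst d) (MeasurableSet.univ_pi hs), hpre,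
    Measure.prod_prod, Measure.pi_pi, ← Finset.mul_prod_erase _ _ (Finset.mem_univ d),
    ← Finset.mul_prod_erase _ (fun i => ν i (s i)) (Finset.mem_univ d), Function.update_self,
    measure_univ, one_mul]
  congr 1
  refine Finset.prod_congr rfl fun i hi => ?_
  rw [Function.update_of_ne (Finset.ne_of_mem_erase hi)]

end Resampling

section Mixture

variable {V : Type*}

theorem measurableSet_lt_apply (c : ℝ) (i : V) : MeasurableSet {x : V → ℝ | c < x i} :=
  measurable_pi_apply i measurableSet_Ioi

theorem image_smul_eq_preimage {t : ℝ} (ht : 0 < t) (A : Set (V → ℝ)) :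
    (fun x => t • x) '' A = (t⁻¹ • ·) ⁻¹' A :=
  Set.image_smul.trans (Set.preimage_smul_inv₀ ht.ne' A).symm

theorem measurable_fst_smul_snd : Measurable fun q : ℝ × (V → ℝ) => q.1 • q.2 :=
  measurable_pi_lambda _ fun i => measurable_fst.mul ((measurable_pi_apply i).comp measurable_snd)

/-- The law of `R • W`, where `R ∼ ρ` and `W ∼ ν` are independent. For `ρ = stdPareto` this is
`paretoMixture ν`; for `ρ = powerMeasure` it is the homogeneous measure that extends the latter. -/
noncomputable def scaleMixture (ρ : Measure ℝ) (ν : Measure (V → ℝ)) : Measure (V → ℝ) :=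
  (ρ.prod ν).map fun q => q.1 • q.2

theorem map_smul_scaleMixture_powerMeasure (ν : Measure (V → ℝ)) [SFinite ν] {t : ℝ}
    (ht : 0 < t) :
    (scaleMixture powerMeasure ν).map (t • ·) =
      ENNReal.ofReal t • scaleMixture powerMeasure ν := by
  have hcomp : ((t • ·) ∘ fun q : ℝ × (V → ℝ) => q.1 • q.2) =
      (fun q => q.1 • q.2) ∘ Prod.map (t * ·) id := by
    ext q v
    simp [mul_assoc]
  rw [scaleMixture, Measure.map_map (by fun_prop) measurable_fst_smul_snd, hcomp,
    ← Measure.map_map measurable_fst_smul_snd (by fun_prop), ← Measure.map_prod_map _ _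
      (by fun_prop) measurable_id, map_mul_left_powerMeasure ht, Measure.map_id,
    Measure.prod_smul_left, Measure.map_smul]

theorem restrict_scaleMixture_powerMeasure {ν : Measure (V → ℝ)} [SFinite ν]
    {g : (V → ℝ) → ℝ} (hg : Measurable g) (hg_smul : ∀ t : ℝ, 0 < t → ∀ x, g (t • x) = t * g x)
    (hg_one : ∀ᵐ w ∂ν, g w = 1) :
    (scaleMixture powerMeasure ν).restrict {x | 1 < g x} = paretoMixture ν := by
  have hpre : ((fun q : ℝ × (V → ℝ) => q.1 • q.2) ⁻¹' {x | 1 < g x} : Set (ℝ × (V → ℝ)))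
      =ᵐ[powerMeasure.prod ν] Set.Ioi 1 ×ˢ Set.univ := by
    filter_upwards [Measure.quasiMeasurePreserving_fst.ae ae_powerMeasure_pos,
      Measure.quasiMeasurePreserving_snd.ae hg_one] with q hr hw
    have hgq : g (q.1 • q.2) = q.1 := by rw [hg_smul _ hr, hw, mul_one]
    exact propext ((iff_of_eq (congrArg (1 < ·) hgq)).trans (and_iff_left trivial).symm)
  have hmeas : MeasurableSet {x | 1 < g x} := hg measurableSet_Ioi
  rw [scaleMixture, Measure.restrict_map measurable_fst_smul_snd hmeas,
    Measure.restrict_congr_set hpre, ← Measure.prod_restrict, Measure.restrict_univ,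
    ← stdPareto_eq_restrict, paretoMixture]

-- Given that the profile `x / g x` lies in `A`, homogeneity makes the radius `g x` Pareto.
theorem eq_paretoMixture_map_inv_smul {μ : Measure (V → ℝ)} [IsFiniteMeasure μ]
    {g : (V → ℝ) → ℝ} (hg : Measurable g) (hg_smul : ∀ t : ℝ, 0 < t → ∀ x, g (t • x) = t * g x)
    (hg_one : ∀ᵐ x ∂μ, 1 < g x)
    (hμ : ∀ t : ℝ, 1 ≤ t → μ.restrict {x | t < g x} = (ENNReal.ofReal t)⁻¹ • μ.map (t • ·)) :
    μ = paretoMixture (μ.map fun x => (g x)⁻¹ • x) := by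
  let profile (x : V → ℝ) : V → ℝ := (g x)⁻¹ • x
  have hprofile : Measurable profile := measurable_fst_smul_snd.comp (hg.inv.prodMk measurable_id)
  have hpolar : μ.map (fun x => (g x, profile x)) = stdPareto.prod (μ.map profile) := by
    refine (Measure.prod_eq fun B A hB hA => ?_).symm
    let ρ : Measure ℝ := (μ.restrict (profile ⁻¹' A)).map g
    have hρ : ρ = ρ Set.univ • stdPareto := by
      have hradius (t : ℝ) (ht : 1 ≤ t) :
          ρ (Set.Ioi t) = (ENNReal.ofReal t)⁻¹ * μ (profile ⁻¹' A) := by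
        have ht0 : 0 < t := one_pos.trans_le ht
        have hinv : (t • ·) ⁻¹' (profile ⁻¹' A) = profile ⁻¹' A := by
          ext x
          simp [profile, hg_smul t ht0, smul_smul, ht0.ne', mul_comm]
        rw [Measure.map_apply hg measurableSet_Ioi, Measure.restrict_apply' (hprofile hA),
          Set.inter_comm, ← Measure.restrict_apply (hprofile hA)]
        change μ.restrict {x | t < g x} _ = _
        rw [hμ t ht, Measure.smul_apply, Measure.map_apply (by fun_prop) (hprofile hA), hinv,
          smul_eq_mul]
      refine eq_smul_stdPareto fun t ht => ?_
      rw [hradius t ht, Measure.map_apply hg .univ, Set.preimage_univ,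
        Measure.restrict_apply_univ]
    have huniv : ρ Set.univ = μ.map profile A := by
      rw [Measure.map_apply hg .univ, Set.preimage_univ, Measure.restrict_apply_univ,
        Measure.map_apply hprofile hA]
    rw [Measure.map_apply (hg.prodMk hprofile) (hB.prod hA), Set.mk_preimage_prod,
      ← Measure.restrict_apply (hg hB), ← Measure.map_apply hg hB, mul_comm, ← huniv,
      ← smul_eq_mul, ← Measure.smul_apply, ← hρ]
  rw [paretoMixture, ← hpolar, Measure.map_map measurable_fst_smul_snd (hg.prodMk hprofile)]
  refine (Measure.map_id.symm.trans (Measure.map_congr ?_))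
  filter_upwards [hg_one] with x hx
  simp [profile, smul_smul, (one_pos.trans hx).ne']

end Mixture

section TreeMeasure

variable {V : Type*} {T : SimpleGraph V} (hT : T.IsTree)

/-- The vector `(r ∏_{e ∈ ph(mi)} w_e)_i` as a function of the pair `q = (r, w)`. -/
noncomputable def treeVec (m : V) (q : ℝ × (T.Dart → ℝ)) : V → ℝ :=
  q.1 • pathProduct hT Function.eval m q.2

/-- The vector with value `q.1.1` at `m` and value `q.1.2` at a neighbour `m'` of `m`, continued
away from the edge `{m, m'}` by multiplying with the weights `q.2`. -/
noncomputable def twoRootVec (m m' : V) (q : (ℝ × ℝ) × (T.Dart → ℝ)) (v : V) : ℝ :=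
  if T.dist m' v = T.dist m v + 1 then q.1.1 * pathProduct hT Function.eval m q.2 v
  else q.1.2 * pathProduct hT Function.eval m' q.2 v

@[simp]
theorem treeVec_root (m : V) (q : ℝ × (T.Dart → ℝ)) : treeVec hT m q m = q.1 := by
  simp [treeVec]

theorem treeVec_snd {m : V} {e : T.Dart} (he : e ∈ outwardEdges T m) (q : ℝ × (T.Dart → ℝ)) :
    treeVec hT m q e.snd = treeVec hT m q e.fst * q.2 e := by
  simp [treeVec, pathProduct_snd hT _ he, mul_assoc]

theorem measurable_pathProduct_eval (m v : V) :
    Measurable fun w : T.Dart → ℝ => pathProduct hT Function.eval m w v :=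
  measurable_pi_iff.1 (measurable_pathProduct hT measurable_pi_apply m) v

@[fun_prop]
theorem measurable_treeVec (m : V) : Measurable (treeVec hT m) :=
  measurable_pi_lambda _ fun v =>
    measurable_fst.mul ((measurable_pathProduct_eval hT m v).comp measurable_snd)

@[fun_prop]
theorem measurable_twoRootVec (m m' : V) : Measurable (twoRootVec hT m m') := by
  refine measurable_pi_lambda _ fun v => ?_
  unfold twoRootVec
  split_ifs
  · exact measurable_fst.fst.mul ((measurable_pathProduct_eval hT m v).comp measurable_snd)
  · exact measurable_fst.snd.mul ((measurable_pathProduct_eval hT m' v).comp measurable_snd)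

theorem twoRootVec_swap {m m' : V} (h : T.Adj m m') (q : (ℝ × ℝ) × (T.Dart → ℝ)) :
    twoRootVec hT m' m (q.1.swap, q.2) = twoRootVec hT m m' q := by
  ext v
  obtain hv | hv := dist_eq_dist_add_one_or hT h v <;> simp [twoRootVec, hv, Nat.add_assoc]

theorem twoRootVec_right {m m' : V} (q : (ℝ × ℝ) × (T.Dart → ℝ)) :
    twoRootVec hT m m' q m' = q.1.2 := by
  simp [twoRootVec]

theorem twoRootVec_left {m m' : V} (h : T.Adj m m') (q : (ℝ × ℝ) × (T.Dart → ℝ)) :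
    twoRootVec hT m m' q m = q.1.1 := by
  rw [← twoRootVec_swap hT h, twoRootVec_right, Prod.fst_swap.symm, Prod.swap_swap]

theorem treeVec_update [DecidableEq T.Dart] {m m' : V} (h : T.Adj m m') (r u : ℝ)
    (w : T.Dart → ℝ) :
    treeVec hT m (r, Function.update w ⟨(m, m'), h⟩ u) =
      twoRootVec hT m m' ((r, r * u), w) := by
  ext v
  have hcongr {n : V} (hn : (⟨(m, m'), h⟩ : T.Dart) ∉ (treePath hT n v).darts) :
      pathProduct hT Function.eval n (Function.update w ⟨(m, m'), h⟩ u) v =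
        pathProduct hT Function.eval n w v :=
    pathProduct_congr hT fun d hd => Function.update_of_ne (by rintro rfl; exact hn hd) _ _
  simp only [treeVec, twoRootVec, Pi.smul_apply, smul_eq_mul]
  split_ifs with hv
  · rw [hcongr (notMem_darts_treePath_of_dist_eq hT h hv (.inr rfl))]
  · have hv' := (dist_eq_dist_add_one_or hT h v).resolve_right hv
    rw [pathProduct_eq_mul hT _ h hv', Function.eval, Function.update_self,
      hcongr (notMem_darts_treePath_of_dist_eq hT h.symm hv' (.inl rfl)), mul_assoc]

variable [Fintype T.Dart]

/-- The law of `(R ∏_{e ∈ ph(mi)} W_e)_i`, for independent `R ∼ ρ` and `W_e ∼ ν e`. -/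
noncomputable def treeMeasure (m : V) (ρ : Measure ℝ) (ν : T.Dart → Measure ℝ) :
    Measure (V → ℝ) :=
  scaleMixture ρ ((Measure.pi ν).map (pathProduct hT Function.eval m))

variable {ρ : Measure ℝ} [SFinite ρ] {ν : T.Dart → Measure ℝ} [∀ e, IsProbabilityMeasure (ν e)]

theorem treeMeasure_eq_map_treeVec (m : V) :
    treeMeasure hT m ρ ν = (ρ.prod (Measure.pi ν)).map (treeVec hT m) := by
  have hpath := measurable_pathProduct hT measurable_pi_apply m
  have := Measure.map_prod_map ρ (Measure.pi ν) measurable_id hpath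
  rw [Measure.map_id] at this
  rw [treeMeasure, scaleMixture, this, Measure.map_map measurable_fst_smul_snd (by fun_prop)]
  rfl

instance [IsProbabilityMeasure ρ] (m : V) : IsProbabilityMeasure (treeMeasure hT m ρ ν) := by
  rw [treeMeasure_eq_map_treeVec]
  exact Measure.isProbabilityMeasure_map (by fun_prop)

theorem ae_treeMeasure_of_forall (hν : ∀ e, ∀ᵐ u ∂ν e, 0 ≤ u) (hρ : ∀ᵐ r ∂ρ, 0 < r) (m : V)
    {p : (V → ℝ) → Prop} (hp : MeasurableSet {x | p x})
    (h : ∀ q : ℝ × (T.Dart → ℝ), 0 < q.1 → (∀ d, 0 ≤ q.2 d) → p (treeVec hT m q)) :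
    ∀ᵐ x ∂treeMeasure hT m ρ ν, p x := by
  rw [treeMeasure_eq_map_treeVec, ae_map_iff (by fun_prop) hp]
  have hweights : ∀ᵐ w ∂Measure.pi ν, ∀ d, 0 ≤ w d :=
    ae_all_iff.2 fun d => (measurePreserving_eval ν d).quasiMeasurePreserving.ae (hν d)
  filter_upwards [Measure.quasiMeasurePreserving_fst.ae hρ,
    Measure.quasiMeasurePreserving_snd.ae hweights] with q hr hw using h q hr hw

theorem map_smul_treeMeasure (m : V) {t : ℝ} (ht : 0 < t) :
    (treeMeasure hT m powerMeasure ν).map (t • ·) =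
      ENNReal.ofReal t • treeMeasure hT m powerMeasure ν :=
  map_smul_scaleMixture_powerMeasure _ ht

theorem restrict_treeMeasure_powerMeasure (m : V) :
    (treeMeasure hT m powerMeasure ν).restrict {x | 1 < x m} = treeMeasure hT m stdPareto ν := by
  have hmeas : MeasurableSet {w : V → ℝ | w m = 1} :=
    measurable_pi_apply m (measurableSet_singleton 1)
  refine restrict_scaleMixture_powerMeasure (measurable_pi_apply m) (fun _ _ _ => rfl) ?_
  rw [ae_map_iff (measurable_pathProduct hT measurable_pi_apply m).aemeasurable hmeas]
  exact .of_forall fun w => pathProduct_self hT _ m w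

theorem treeMeasure_eq_map_twoRootVec {m m' : V} (h : T.Adj m m') :
    treeMeasure hT m ρ ν =
      (((ρ.prod (ν ⟨(m, m'), h⟩)).map fun p => (p.1, p.1 * p.2)).prod (Measure.pi ν)).map
        (twoRootVec hT m m') := by
  classical
  let d : T.Dart := ⟨(m, m'), h⟩
  have hupdate := measurable_update_snd_fst (α := fun _ : T.Dart => ℝ) d
  calc treeMeasure hT m ρ ν
      = ((ρ.prod ((ν d).prod (Measure.pi ν))).map
          (Prod.map id fun p => Function.update p.2 d p.1)).map (treeVec hT m) := by
        rw [← Measure.map_prod_map _ _ measurable_id hupdate, map_update_prod_pi ν d,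
          Measure.map_id, treeMeasure_eq_map_treeVec]
    _ = ((ρ.prod (ν d)).prod (Measure.pi ν)).map
          (twoRootVec hT m m' ∘ Prod.map (fun p => (p.1, p.1 * p.2)) id) := by
        rw [← Measure.prodAssoc_prod, Measure.map_map (by fun_prop) (by fun_prop),
          Measure.map_map (by fun_prop) (by fun_prop)]
        exact congrArg (Measure.map · _) (funext fun q => treeVec_update hT h q.1.1 q.1.2 q.2)
    _ = _ := by
        rw [← Measure.map_map (by fun_prop) (by fun_prop),
          ← Measure.map_prod_map _ _ (by fun_prop) measurable_id, Measure.map_id]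

theorem treeMeasure_eq_map_twoRootVec_swap {m m' : V} (h : T.Adj m m') :
    treeMeasure hT m' ρ ν =
      (((ρ.prod (ν ⟨(m', m), h.symm⟩)).map fun p => (p.1 * p.2, p.1)).prod (Measure.pi ν)).map
        (twoRootVec hT m m') := by
  have hswap : twoRootVec hT m' m = twoRootVec hT m m' ∘ Prod.map Prod.swap id :=
    funext fun q => (twoRootVec_swap hT h (q.1.swap, q.2)).trans rfl
  rw [treeMeasure_eq_map_twoRootVec hT h.symm, hswap, ← Measure.map_map (by fun_prop)
    (by fun_prop), ← Measure.map_prod_map _ _ measurable_swap measurable_id, Measure.map_id,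
    Measure.map_map measurable_swap (by fun_prop)]
  rfl

theorem treeMeasure_restrict_pos_of_adj (hdual : ∀ e, LawDuality (ν e) (ν e.symm)) {m m' : V}
    (h : T.Adj m m') :
    (treeMeasure hT m powerMeasure ν).restrict ({x | 0 < x m} ∩ {x | 0 < x m'}) =
      (treeMeasure hT m' powerMeasure ν).restrict ({x | 0 < x m} ∩ {x | 0 < x m'}) := by
  have hpos := measurableSet_lt_apply (V := V) 0
  have hpre : twoRootVec hT m m' ⁻¹' ({x | 0 < x m} ∩ {x | 0 < x m'}) =
      (Set.Ioi 0 ×ˢ Set.Ioi 0) ×ˢ Set.univ := by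
    ext q
    simp [twoRootVec_left hT h, twoRootVec_right]
  rw [treeMeasure_eq_map_twoRootVec hT h, treeMeasure_eq_map_twoRootVec_swap hT h,
    Measure.restrict_map (by fun_prop) ((hpos m).inter (hpos m')),
    Measure.restrict_map (by fun_prop) ((hpos m).inter (hpos m')), hpre, ← Measure.prod_restrict,
    ← Measure.prod_restrict, (hdual ⟨(m, m'), h⟩).restrict_map_prod_powerMeasure]
  rfl

-- Positivity at `e.snd` or beyond forces positivity at `e.fst`, which lies between both roots.
theorem treeMeasure_restrict_pos (hν : ∀ e, ∀ᵐ u ∂ν e, 0 ≤ u)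
    (hdual : ∀ e, LawDuality (ν e) (ν e.symm)) (m m' : V) :
    (treeMeasure hT m powerMeasure ν).restrict ({x | 0 < x m} ∩ {x | 0 < x m'}) =
      (treeMeasure hT m' powerMeasure ν).restrict ({x | 0 < x m} ∩ {x | 0 < x m'}) := by
  have hpos := measurableSet_lt_apply (V := V) 0
  induction m' using outward_induction hT (m := m) with
  | root => rfl
  | step e he ih =>
    refine restrict_inter_eq_trans ih (treeMeasure_restrict_pos_of_adj hT hdual e.adj) ?_ ?_
    · refine ae_treeMeasure_of_forall hT hν ae_powerMeasure_pos m ((hpos _).imp (hpos _))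
        fun q _ hw h => ?_
      change 0 < treeVec hT m q e.snd at h
      rw [treeVec_snd hT he] at h
      exact pos_of_mul_pos_left h (hw e)
    · refine ae_treeMeasure_of_forall hT hν ae_powerMeasure_pos e.snd ((hpos _).imp (hpos _))
        fun q _ hw h => ?_
      have hdist : T.dist e.snd m = T.dist e.fst m + 1 := by
        rwa [SimpleGraph.dist_comm, SimpleGraph.dist_comm (u := e.fst)]
      have hfst : e.symm ∈ outwardEdges T e.snd := by
        simp [outwardEdges, SimpleGraph.dist_eq_one_iff_adj.2 e.adj.symm]
      change 0 < treeVec hT e.snd q m at h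
      change 0 < treeVec hT e.snd q e.symm.snd
      rw [treeVec_snd hT hfst]
      rw [treeVec, Pi.smul_apply, smul_eq_mul, pathProduct_eq_mul hT _ e.adj.symm hdist,
        ← mul_assoc] at h
      convert! pos_of_mul_pos_left h (pathProduct_nonneg hT hw _ _) using 2
      exact treeVec_root hT _ _

end TreeMeasure

section ExponentMeasure

variable {V : Type*}

theorem measurableSet_paretoSupport [Countable V] : MeasurableSet (paretoSupport V) := by
  have heq : paretoSupport V = (⋂ i, {x : V → ℝ | 0 ≤ x i}) ∩ ⋃ i, {x | 1 < x i} := by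
    ext x
    simp [paretoSupport]
  rw [heq]
  exact (MeasurableSet.iInter fun i => measurable_pi_apply i measurableSet_Ici).inter
    (MeasurableSet.iUnion (measurableSet_lt_apply 1))

/-- `Λ` is the exponent measure of a multivariate Pareto distribution: a non-negative homogeneous
measure with standardized margins, of which the Pareto distribution is the conditioning on `𝓛`.
Nothing is required of the mass at the origin. -/
structure IsExponentMeasure (Λ : Measure (V → ℝ)) : Prop where
  ae_nonneg : ∀ᵐ x ∂Λ, ∀ i, 0 ≤ x i
  map_smul : ∀ t : ℝ, 0 < t → Λ.map (t • ·) = ENNReal.ofReal t • Λ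
  measure_one_lt : ∀ i, Λ {x | 1 < x i} = 1

namespace IsExponentMeasure

variable {Λ Λ' : Measure (V → ℝ)} (h : IsExponentMeasure Λ)

include h

theorem measure_preimage_smul {t : ℝ} (ht : 0 < t) {A : Set (V → ℝ)} (hA : MeasurableSet A) :
    Λ ((t • ·) ⁻¹' A) = ENNReal.ofReal t * Λ A := by
  rw [← Measure.map_apply (by fun_prop) hA, h.map_smul t ht, Measure.smul_apply, smul_eq_mul]

theorem restrict_eq_smul_map {t : ℝ} (ht : 0 < t) {A : Set (V → ℝ)} (hA : MeasurableSet A) :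
    Λ.restrict A = (ENNReal.ofReal t)⁻¹ • (Λ.restrict ((t • ·) ⁻¹' A)).map (t • ·) := by
  have ht0 : ENNReal.ofReal t ≠ 0 := by simpa using ht
  rw [← Measure.restrict_map (by fun_prop) hA, h.map_smul t ht, Measure.restrict_smul, smul_smul,
    ENNReal.inv_mul_cancel ht0 ENNReal.ofReal_ne_top, one_smul]

theorem restrict_lt_apply_eq_smul_map {t : ℝ} (ht : 0 < t) (m : V) :
    Λ.restrict {x | t < x m} =
      (ENNReal.ofReal t)⁻¹ • (Λ.restrict {x | 1 < x m}).map (t • ·) := by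
  have hpre : (t • ·) ⁻¹' {x : V → ℝ | t < x m} = {x | 1 < x m} := by
    ext x
    simp [ht]
  rw [h.restrict_eq_smul_map ht (measurableSet_lt_apply t m), hpre]

theorem measure_lt_apply {t : ℝ} (ht : 0 < t) (m : V) :
    Λ {x | t < x m} = (ENNReal.ofReal t)⁻¹ := by
  have := congrArg (· Set.univ) (h.restrict_lt_apply_eq_smul_map ht m)
  simpa [Measure.map_apply (measurable_const_smul t) .univ, h.measure_one_lt] using this

theorem isFiniteMeasure_restrict {t : ℝ} (ht : 0 < t) (m : V) :
    IsFiniteMeasure (Λ.restrict {x | t < x m}) :=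
  ⟨by simpa [h.measure_lt_apply ht] using ht⟩

theorem isProbabilityMeasure_restrict (m : V) :
    IsProbabilityMeasure (Λ.restrict {x | 1 < x m}) :=
  ⟨by simp [h.measure_one_lt]⟩

theorem paretoSupport_ae_eq : paretoSupport V =ᵐ[Λ] (⋃ i, {x | 1 < x i} : Set (V → ℝ)) := by
  filter_upwards [h.ae_nonneg] with x hx
  refine propext (Iff.trans (and_iff_right hx) ?_)
  exact (Set.mem_iUnion (s := fun i => {x : V → ℝ | 1 < x i})).symm

theorem paretoSupport_inter_ae_eq (m : V) :
    (paretoSupport V ∩ {x | 1 < x m} : Set (V → ℝ)) =ᵐ[Λ] {x | 1 < x m} := by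
  filter_upwards [h.ae_nonneg] with x hx
  exact propext ⟨fun hxm => hxm.2, fun hxm => ⟨⟨hx, m, hxm⟩, hxm⟩⟩

theorem measure_paretoSupport_ne_zero [Nonempty V] : Λ (paretoSupport V) ≠ 0 := by
  obtain ⟨m⟩ := ‹Nonempty V›
  intro h0
  have := measure_congr (h.paretoSupport_inter_ae_eq m)
  rw [measure_mono_null Set.inter_subset_left h0, h.measure_one_lt] at this
  exact zero_ne_one this

theorem measure_paretoSupport_ne_top [Finite V] : Λ (paretoSupport V) ≠ ∞ := by
  have := Fintype.ofFinite V
  rw [measure_congr h.paretoSupport_ae_eq]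
  refine ((measure_iUnion_fintype_le Λ _).trans_lt ?_).ne
  simp [h.measure_one_lt]

theorem exceedanceLaw_cond [Finite V] (m : V) :
    exceedanceLaw (cond Λ (paretoSupport V)) m = Λ.restrict {x | 1 < x m} := by
  rw [exceedanceLaw, cond_cond_eq_cond_inter' measurableSet_paretoSupport
    (measurableSet_lt_apply 1 m) h.measure_paretoSupport_ne_top, ProbabilityTheory.cond,
    measure_congr (h.paretoSupport_inter_ae_eq m), h.measure_one_lt, inv_one, one_smul,
    Measure.restrict_congr_set (h.paretoSupport_inter_ae_eq m)]

theorem isMultivariatePareto_cond [Finite V] [Nonempty V] :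
    IsMultivariatePareto (cond Λ (paretoSupport V)) where
  isProbabilityMeasure := cond_isProbabilityMeasure_of_finite h.measure_paretoSupport_ne_zero
    h.measure_paretoSupport_ne_top
  ae_mem_support := ae_cond_mem measurableSet_paretoSupport
  homogeneous t ht A hA hAL := by
    have ht0 : 0 < t := one_pos.trans_le ht
    have hsub : (fun x => t • x) '' A ⊆ paretoSupport V := by
      rintro _ ⟨x, hx, rfl⟩
      obtain ⟨hnonneg, i, hi⟩ := hAL hx
      exact ⟨fun j => mul_nonneg ht0.le (hnonneg j), i, one_lt_mul_of_le_of_lt ht hi⟩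
    rw [cond_apply measurableSet_paretoSupport, cond_apply measurableSet_paretoSupport,
      Set.inter_eq_right.2 hsub, Set.inter_eq_right.2 hAL, image_smul_eq_preimage ht0,
      h.measure_preimage_smul (inv_pos.2 ht0) hA, ENNReal.ofReal_inv_of_pos ht0, mul_left_comm]
  margins i j := by
    simp only [cond_apply measurableSet_paretoSupport,
      measure_congr (h.paretoSupport_inter_ae_eq _), h.measure_one_lt]

theorem cond_paretoSupport_eq [Countable V] (h' : IsExponentMeasure Λ')
    (heq : ∀ m, Λ.restrict {x | 1 < x m} = Λ'.restrict {x | 1 < x m}) :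
    cond Λ (paretoSupport V) = cond Λ' (paretoSupport V) := by
  have hrestrict : Λ.restrict (paretoSupport V) = Λ'.restrict (paretoSupport V) := by
    rw [Measure.restrict_congr_set h.paretoSupport_ae_eq,
      Measure.restrict_congr_set h'.paretoSupport_ae_eq, Measure.restrict_iUnion_congr.2 heq]
  rw [ProbabilityTheory.cond, ProbabilityTheory.cond, ← Measure.restrict_apply_univ, hrestrict,
    Measure.restrict_apply_univ]

end IsExponentMeasure

theorem lt_norm_of_lt_apply [Fintype V] {x : V → ℝ} {t : ℝ} {i : V} (h : t < x i) : t < ‖x‖ :=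
  h.trans_le ((le_abs_self _).trans (norm_le_pi_norm x i))

namespace IsMultivariatePareto

variable {μ : Measure (V → ℝ)} (h : IsMultivariatePareto μ)

include h

theorem measure_one_lt_ne_zero [Countable V] (m : V) : μ {x | 1 < x m} ≠ 0 := by
  have := h.isProbabilityMeasure
  intro h0
  have hnull : μ (⋃ i, {x | 1 < x i}) = 0 := measure_iUnion_null fun i => h.margins i m ▸ h0
  have hfull : ∀ᵐ x ∂μ, x ∈ ⋃ i, {x : V → ℝ | 1 < x i} :=
    h.ae_mem_support.mono fun x hx => Set.mem_iUnion.2 hx.2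
  obtain ⟨x, hx, hx'⟩ := ((measure_eq_zero_iff_ae_notMem.1 hnull).and hfull).exists
  exact hx hx'

section Norm

variable [Fintype V]

theorem restrict_lt_norm {t : ℝ} (ht : 1 ≤ t) :
    μ.restrict {x | t < ‖x‖} = (ENNReal.ofReal t)⁻¹ • μ.map (t • ·) := by
  have ht0 : 0 < t := one_pos.trans_le ht
  refine Measure.ext fun A hA => ?_
  let B : Set (V → ℝ) := (t • ·) ⁻¹' A ∩ paretoSupport V
  have himage : (A ∩ {x | t < ‖x‖} : Set (V → ℝ)) =ᵐ[μ] (fun x => t • x) '' B := by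
    filter_upwards [h.ae_mem_support] with x ⟨hx, _⟩
    refine propext ?_
    change x ∈ A ∧ t < ‖x‖ ↔ x ∈ (fun x => t • x) '' B
    have hnorm : t < ‖x‖ ↔ t⁻¹ • x ∈ paretoSupport V := by
      rw [← not_le, pi_norm_le_iff_of_nonneg ht0.le]
      simp [paretoSupport, hx, ht0, lt_inv_mul_iff₀, abs_of_nonneg]
    rw [image_smul_eq_preimage ht0, hnorm]
    simp [B, smul_smul, ht0.ne']
  have hB : B =ᵐ[μ] ((t • ·) ⁻¹' A : Set (V → ℝ)) := by
    filter_upwards [h.ae_mem_support] with x hx using propext (and_iff_left hx)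
  have hBmeas : MeasurableSet B :=
    (measurable_const_smul t hA).inter measurableSet_paretoSupport
  rw [Measure.restrict_apply hA, measure_congr himage,
    h.homogeneous t ht B hBmeas Set.inter_subset_right, measure_congr hB, Measure.smul_apply,
    Measure.map_apply (by fun_prop) hA, smul_eq_mul]

theorem exists_eq_paretoMixture_norm_eq_one : ∃ σ : Measure (V → ℝ), IsFiniteMeasure σ ∧
    (∀ᵐ w ∂σ, ‖w‖ = 1) ∧ (∀ᵐ w ∂σ, ∀ i, 0 ≤ w i) ∧ μ = paretoMixture σ := by
  have := h.isProbabilityMeasure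
  have hnorm : ∀ᵐ x ∂μ, 1 < ‖x‖ :=
    h.ae_mem_support.mono fun x ⟨_, _, hi⟩ => lt_norm_of_lt_apply hi
  have hprofile : AEMeasurable (fun x : V → ℝ => ‖x‖⁻¹ • x) μ := by fun_prop
  refine ⟨μ.map fun x => ‖x‖⁻¹ • x, inferInstance, ?_, ?_,
    eq_paretoMixture_map_inv_smul measurable_norm (fun t ht x => ?_) hnorm
      fun t ht => h.restrict_lt_norm ht⟩
  · refine (ae_map_iff hprofile (measurable_norm (measurableSet_singleton 1))).2 ?_
    filter_upwards [hnorm] with x hx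
    exact norm_smul_inv_norm (𝕜 := ℝ) (norm_pos_iff.1 (one_pos.trans hx))
  · refine (ae_map_iff hprofile (by measurability)).2 ?_
    filter_upwards [h.ae_mem_support] with x hx i
    exact mul_nonneg (inv_nonneg.2 (norm_nonneg x)) (hx.1 i)
  · rw [norm_smul, Real.norm_of_nonneg ht.le]

end Norm

theorem exists_isExponentMeasure [Finite V] :
    ∃ Λ, IsExponentMeasure Λ ∧ cond Λ (paretoSupport V) = μ := by
  have := Fintype.ofFinite V
  have := h.isProbabilityMeasure
  obtain ⟨_, _, m, _⟩ := h.ae_mem_support.exists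
  let p : ℝ≥0∞ := μ {x | 1 < x m}
  have hp : p ≠ 0 := h.measure_one_lt_ne_zero m
  have hp' : p ≠ ∞ := measure_ne_top μ _
  obtain ⟨σ, _, hσ_norm, hσ_nonneg, hσ⟩ := h.exists_eq_paretoMixture_norm_eq_one
  let M : Measure (V → ℝ) := scaleMixture powerMeasure σ
  have hM : M.restrict {x | 1 < ‖x‖} = μ := by
    refine (restrict_scaleMixture_powerMeasure measurable_norm (fun t ht x => ?_) hσ_norm).trans
      hσ.symm
    rw [norm_smul, Real.norm_of_nonneg ht.le]
  have hrestrict {A : Set (V → ℝ)} (hA : A ⊆ {x | 1 < ‖x‖}) : M.restrict A = μ.restrict A := by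
    rw [← hM, Measure.restrict_restrict_of_subset hA]
  refine ⟨p⁻¹ • M, ⟨?_, fun t ht => ?_, fun i => ?_⟩, ?_⟩
  · refine Measure.ae_smul_measure ((ae_map_iff (by fun_prop) (by measurability)).2 ?_) _
    filter_upwards [Measure.quasiMeasurePreserving_fst.ae ae_powerMeasure_pos,
      Measure.quasiMeasurePreserving_snd.ae hσ_nonneg] with q hr hw i
    exact mul_nonneg hr.le (hw i)
  · rw [Measure.map_smul, map_smul_scaleMixture_powerMeasure _ ht, smul_comm]
  · have hsub : {x : V → ℝ | 1 < x i} ⊆ {x | 1 < ‖x‖} := fun _ hx => lt_norm_of_lt_apply hx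
    rw [Measure.smul_apply, ← Measure.restrict_apply_univ, hrestrict hsub,
      Measure.restrict_apply_univ, h.margins i m, smul_eq_mul, ENNReal.inv_mul_cancel hp hp']
  · have hsub : paretoSupport V ⊆ {x | 1 < ‖x‖} := fun _ ⟨_, _, hi⟩ => lt_norm_of_lt_apply hi
    have hL : M.restrict (paretoSupport V) = μ :=
      (hrestrict hsub).trans (Measure.restrict_eq_self_of_ae_mem h.ae_mem_support)
    have hL_apply : M (paretoSupport V) = 1 := by
      rw [← Measure.restrict_apply_univ, hL, measure_univ]
    rw [ProbabilityTheory.cond, Measure.restrict_smul, hL, Measure.smul_apply, hL_apply,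
      smul_eq_mul, mul_one, inv_inv, smul_smul, ENNReal.mul_inv_cancel hp hp', one_smul]

end IsMultivariatePareto

end ExponentMeasure

section TreeConstruction

variable {V : Type*} [Finite V] {T : SimpleGraph V} [Fintype T.Dart] (hT : T.IsTree)
  {ν : T.Dart → Measure ℝ} [∀ e, IsProbabilityMeasure (ν e)]

theorem exists_isExponentMeasure_restrict_eq_treeMeasure (hν : ∀ e, ∀ᵐ u ∂ν e, 0 ≤ u)
    (hdual : ∀ e, LawDuality (ν e) (ν e.symm)) :
    ∃ Λ, IsExponentMeasure Λ ∧
      ∀ m, Λ.restrict {x | 1 < x m} = treeMeasure hT m stdPareto ν := by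
  let pos (m : V) : Set (V → ℝ) := {x | 0 < x m}
  have hpos (m : V) : MeasurableSet (pos m) := measurableSet_lt_apply 0 m
  have hpos_ae (m : V) : ∀ᵐ x ∂treeMeasure hT m powerMeasure ν, x ∈ pos m :=
    ae_treeMeasure_of_forall hT hν ae_powerMeasure_pos m (hpos m)
      fun q hr _ => hr.trans_eq (treeVec_root hT m q).symm
  have hnonneg_ae (m : V) : ∀ᵐ x ∂treeMeasure hT m powerMeasure ν, ∀ i, 0 ≤ x i :=
    ae_treeMeasure_of_forall hT hν ae_powerMeasure_pos m (by measurability)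
      fun q hr hw i => mul_nonneg hr.le (pathProduct_nonneg hT hw m i)
  have := hT.connected.nonempty
  obtain ⟨Λ, hΛ, hΛ_pos⟩ := exists_measure_restrict_eq hpos hpos_ae
    fun m m' => treeMeasure_restrict_pos hT hν hdual m m'
  have hΛ_one (m : V) : Λ.restrict {x | 1 < x m} = treeMeasure hT m stdPareto ν := by
    rw [← restrict_treeMeasure_powerMeasure, ← hΛ m, Measure.restrict_restrict_of_subset]
    exact fun x (hx : 1 < x m) => one_pos.trans hx
  refine ⟨Λ, ⟨?_, fun t ht => ?_, fun m => ?_⟩, hΛ_one⟩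
  · rw [← Measure.restrict_eq_self_of_ae_mem hΛ_pos, ae_restrict_iUnion_iff]
    exact fun m => hΛ m ▸ hnonneg_ae m
  · refine measure_eq_of_restrict_eq (P := pos) (fun m => ?_) ?_ (Measure.ae_smul_measure hΛ_pos _)
    · have hpre : (t • ·) ⁻¹' pos m = pos m := by
        ext x
        simp [pos, ht]
      rw [Measure.restrict_map (by fun_prop) (hpos m), Measure.restrict_smul, hpre, hΛ,
        map_smul_treeMeasure hT m ht]
    · refine (ae_map_iff (by fun_prop) (MeasurableSet.iUnion hpos)).2 ?_
      filter_upwards [hΛ_pos] with x hx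
      obtain ⟨i, hi⟩ := Set.mem_iUnion.1 hx
      exact Set.mem_iUnion_of_mem i (mul_pos ht hi)
  · rw [← Measure.restrict_apply_univ, hΛ_one, measure_univ]

end TreeConstruction

section Indicator

variable {V : Type*}

@[fun_prop]
theorem measurable_indicator (S : Set V) :
    Measurable (Set.indicator S : (V → ℝ) → V → ℝ) := by
  refine measurable_pi_lambda _ fun v => ?_
  by_cases hv : v ∈ S
  · simpa [hv] using measurable_pi_apply v
  · simp [hv]

theorem indicator_indicator_of_subset {A S : Set V} (hA : A ⊆ S) (x : V → ℝ) :
    A.indicator (S.indicator x) = A.indicator x := by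
  rw [Set.indicator_indicator, Set.inter_eq_left.2 hA]

theorem indicator_insert_eq_update [DecidableEq V] (A : Set V) (j : V) (x : V → ℝ) :
    (insert j A).indicator x = Function.update (A.indicator x) j (x j) := by
  ext v
  obtain rfl | hv := eq_or_ne v j
  · simp
  · by_cases hA : v ∈ A <;> simp [hv, hA]

theorem exists_measurable_apply_indicator_eq {A B : Set V} {i : V} (hi : i ∈ A ∪ B) :
    ∃ l : (V → ℝ) × (V → ℝ) → ℝ, Measurable l ∧
      ∀ x : V → ℝ, l (A.indicator x, B.indicator x) = x i := by
  rcases hi with hi | hi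
  · exact ⟨fun p => p.1 i, by fun_prop, fun x => Set.indicator_of_mem hi x⟩
  · exact ⟨fun p => p.2 i, by fun_prop, fun x => Set.indicator_of_mem hi x⟩

end Indicator

section MarkovChain

variable {V : Type*} {T : SimpleGraph V} {m : V} {κ : T.Dart → Kernel ℝ ℝ} {μ μ' : Measure (V → ℝ)}

/-- `μ` is the law of a Markov chain indexed by the tree `T`, started at the root `m`, that moves
along each outward edge `e` with the transition kernel `κ e`: given the values on a subtree `S`
containing the root, the value at a child of a vertex `i ∈ S` depends on the value at `i` only. The
values on `S` are encoded as the vector `S.indicator x`. -/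
def IsTreeMarkovChain (T : SimpleGraph V) (m : V) (κ : T.Dart → Kernel ℝ ℝ)
    (μ : Measure (V → ℝ)) : Prop :=
  ∀ S, IsRootedSubtree T m S → ∀ e ∈ outwardEdges T m, e.fst ∈ S → e.snd ∉ S →
    HasCondDistrib (Function.eval e.snd) S.indicator
      ((κ e).comap (Function.eval e.fst) (measurable_pi_apply e.fst)) μ

theorem IsTreeMarkovChain.ext [Finite V] (hT : T.IsTree) (h : IsTreeMarkovChain T m κ μ)
    (h' : IsTreeMarkovChain T m κ μ')
    (hroot : μ.map (Function.eval m) = μ'.map (Function.eval m)) : μ = μ' := by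
  classical
  suffices hS : μ.map (Set.univ : Set V).indicator = μ'.map (Set.univ : Set V).indicator by
    have hid : (Set.univ : Set V).indicator = (id : (V → ℝ) → V → ℝ) :=
      funext fun x => Set.indicator_univ x
    rwa [hid, Measure.map_id, Measure.map_id] at hS
  refine IsRootedSubtree.induction hT (m := m)
    (motive := fun S => μ.map S.indicator = μ'.map S.indicator) ?_ ?_ (.univ T m)
  · have hsingle : ({m} : Set V).indicator =
        (fun r : ℝ => Function.update (0 : V → ℝ) m r) ∘ Function.eval m := by
      ext x : 1
      rw [← insert_empty_eq, indicator_insert_eq_update, Set.indicator_empty]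
      rfl
    rw [hsingle, ← Measure.map_map (by fun_prop) (by fun_prop), hroot,
      Measure.map_map (by fun_prop) (by fun_prop)]
  · intro S hS e he hfst hsnd ih
    let upd : (V → ℝ) × ℝ → V → ℝ := fun p => Function.update p.1 e.snd p.2
    have hupd : Measurable upd := measurable_update'
    have hinsert : (insert e.snd S).indicator =
        upd ∘ fun x : V → ℝ => (S.indicator x, Function.eval e.snd x) :=
      funext fun x => indicator_insert_eq_update S e.snd x
    have hpair : Measurable fun x : V → ℝ => (S.indicator x, Function.eval e.snd x) :=
      (measurable_indicator S).prodMk (measurable_pi_apply _)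
    rw [hinsert, ← Measure.map_map hupd hpair, ← Measure.map_map hupd hpair,
      (h S hS e he hfst hsnd).map_eq, (h' S hS e he hfst hsnd).map_eq, ih]

variable [Countable V] [IsFiniteMeasure μ] [∀ e, IsMarkovKernel (κ e)]

theorem IsTreeMarkovChain.condIndepFun_indicator (h : IsTreeMarkovChain T m κ μ) {S : Set V}
    (hS : IsRootedSubtree T m S) {e : T.Dart} (he : e ∈ outwardEdges T m) (hfst : e.fst ∈ S)
    (hsnd : e.snd ∉ S) {A B C : Set V} (hA : A ⊆ S) (hB : B ⊆ S) (hC : C ⊆ S)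
    (hAB : e.fst ∈ A ∪ B) :
    Function.eval e.snd ⟂ᵢ[fun x => (A.indicator x, B.indicator x),
      (measurable_indicator A).prodMk (measurable_indicator B); μ] C.indicator := by
  obtain ⟨l, hl, hlk⟩ := exists_measurable_apply_indicator_eq hAB
  have hedge : S.indicator ⟂ᵢ[Function.eval e.fst, measurable_pi_apply _; μ]
      Function.eval e.snd := by
    refine (condIndepFun_iff_exists_hasCondDistrib (measurable_pi_apply _)
      (measurable_indicator S) (measurable_pi_apply _)).2 ⟨κ e, inferInstance, ?_⟩
    have hpair : (fun x : V → ℝ => (Function.eval e.fst x, S.indicator x)) =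
        (fun y => (Function.eval e.fst y, y)) ∘ S.indicator :=
      funext fun x => Prod.ext (Set.indicator_of_mem hfst x).symm rfl
    rw [hpair]
    exact HasCondDistrib.comp_right (hf := (measurable_pi_apply _).prodMk measurable_id)
      (h S hS e he hfst hsnd)
  have := condIndepFun_comp_prodMk (measurable_pi_apply _) (measurable_indicator S)
    (measurable_pi_apply _) hedge (f := id) measurable_id (g := fun p => C.indicator p.2)
    ((measurable_indicator C).comp measurable_snd)
    (k := fun p => (A.indicator p.2, B.indicator p.2))
    (((measurable_indicator A).comp measurable_snd).prodMk
      ((measurable_indicator B).comp measurable_snd)) hl fun x => by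
      simp only [indicator_indicator_of_subset hA, indicator_indicator_of_subset hB, hlk]
  simp only [indicator_indicator_of_subset hA, indicator_indicator_of_subset hB,
    indicator_indicator_of_subset hC] at this
  exact this.symm

theorem IsTreeMarkovChain.condIndepFun_insert_left (h : IsTreeMarkovChain T m κ μ) {S : Set V}
    (hS : IsRootedSubtree T m S) {e : T.Dart} (he : e ∈ outwardEdges T m) (hfst : e.fst ∈ S)
    (hsnd : e.snd ∉ S) {A B C : Set V} (hA : A ⊆ S) (hB : B ⊆ S) (hC : C ⊆ S)
    (hAB : e.fst ∈ A ∪ B)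
    (hABC : A.indicator ⟂ᵢ[B.indicator, measurable_indicator B; μ] C.indicator) :
    (insert e.snd A).indicator ⟂ᵢ[B.indicator, measurable_indicator B; μ] C.indicator := by
  classical
  have := condIndepFun_prodMk_of_condIndepFun (measurable_indicator C) (measurable_indicator A)
    (measurable_indicator B) (measurable_pi_apply _) hABC
    (h.condIndepFun_indicator hS he hfst hsnd hB hA hC (Set.union_comm A B ▸ hAB))
  convert! this.comp (φ := fun p => Function.update p.1 e.snd p.2) measurable_update'
    measurable_id using 1
  exact funext fun x => indicator_insert_eq_update A e.snd x

theorem IsTreeMarkovChain.condIndepFun_insert_middle (h : IsTreeMarkovChain T m κ μ) {S : Set V}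
    (hS : IsRootedSubtree T m S) {e : T.Dart} (he : e ∈ outwardEdges T m) (hfst : e.fst ∈ S)
    (hsnd : e.snd ∉ S) {A B C : Set V} (hA : A ⊆ S) (hB : B ⊆ S) (hC : C ⊆ S)
    (hAB : e.fst ∈ A ∪ B)
    (hABC : A.indicator ⟂ᵢ[B.indicator, measurable_indicator B; μ] C.indicator) :
    A.indicator ⟂ᵢ[(insert e.snd B).indicator, measurable_indicator _; μ] C.indicator := by
  classical
  have := condIndepFun_prodMk_of_condIndepFun (measurable_indicator C) (measurable_indicator A)
    (measurable_indicator B) (measurable_pi_apply _) hABC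
    (h.condIndepFun_indicator hS he hfst hsnd hB hA hC (Set.union_comm A B ▸ hAB))
  have hB0 (x : V → ℝ) : Function.update (B.indicator x) e.snd 0 = B.indicator x :=
    Function.update_eq_self_iff.2 (Set.indicator_of_notMem (fun hj => hsnd (hB hj)) x).symm
  have hinsert := condIndepFun_comp_prodMk (measurable_indicator C)
    ((measurable_indicator A).prodMk (measurable_pi_apply _)) (measurable_indicator B) this
    (f := id) measurable_id (g := fun p => p.2.1) (by fun_prop)
    (k := fun p => Function.update p.1 e.snd p.2.2)
    (measurable_update'.comp (measurable_fst.prodMk measurable_snd.snd))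
    (l := fun b => Function.update b e.snd 0) (by fun_prop) fun x => by
      simp only [Function.update_idem, hB0]
  simp only [← indicator_insert_eq_update] at hinsert
  exact hinsert

end MarkovChain

section GlobalMarkov

variable {V : Type*} {G T : SimpleGraph V} {A B C A' B' C' : Set V}

/-- `A`, `B`, `C` are pairwise disjoint and no edge of `G` joins `A` to `C`. In contrast to
`Separates`, this only restricts the paths inside `A ∪ B ∪ C`, which suits an induction on that
set. -/
structure IsSeparatedTriple (G : SimpleGraph V) (A B C : Set V) : Prop where
  disjoint_left : Disjoint A B
  disjoint_right : Disjoint B C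
  disjoint : Disjoint A C
  not_adj : ∀ a ∈ A, ∀ c ∈ C, ¬ G.Adj a c

theorem IsSeparatedTriple.symm (h : IsSeparatedTriple G A B C) : IsSeparatedTriple G C B A :=
  ⟨h.disjoint_right.symm, h.disjoint_left.symm, h.disjoint.symm,
    fun c hc a ha hca => h.not_adj a ha c hc hca.symm⟩

theorem IsSeparatedTriple.mono (h : IsSeparatedTriple G A B C) (hA : A' ⊆ A) (hB : B' ⊆ B)
    (hC : C' ⊆ C) : IsSeparatedTriple G A' B' C' :=
  ⟨h.disjoint_left.mono hA hB, h.disjoint_right.mono hB hC, h.disjoint.mono hA hC,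
    fun a ha c hc => h.not_adj a (hA ha) c (hC hc)⟩

theorem Separates.exists_isSeparatedTriple (hAB : Disjoint A B) (hBC : Disjoint B C)
    (h : Separates G A B C) :
    ∃ A' C' : Set V, A ⊆ A' ∧ C ⊆ C' ∧ A' ∪ B ∪ C' = Set.univ ∧ IsSeparatedTriple G A' B C' := by
  classical
  let A' : Set V := {v | ∃ a ∈ A, ∃ p : G.Walk a v, ∀ b ∈ B, b ∉ p.support}
  have hA'B : Disjoint A' B :=
    Set.disjoint_left.2 fun v ⟨_, _, p, hp⟩ hv => hp v hv p.end_mem_support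
  refine ⟨A', (A' ∪ B)ᶜ, fun a ha => ⟨a, ha, .nil, ?_⟩, ?_, Set.union_compl_self _, hA'B,
    disjoint_compl_right.mono_left Set.subset_union_right,
    disjoint_compl_right.mono_left Set.subset_union_left, ?_⟩
  · rintro b hb hb'
    rw [SimpleGraph.Walk.support_nil, List.mem_singleton] at hb'
    exact Set.disjoint_left.1 hAB ha (hb' ▸ hb)
  · rintro c hc (⟨a, ha, p, hp⟩ | hcB)
    · obtain ⟨b, hb, hb'⟩ := h a ha c hc p.bypass p.bypass_isPath
      exact hp b hb (p.support_bypass_subset_support hb')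
    · exact Set.disjoint_left.1 hBC hcB hc
  · rintro v ⟨a, ha, p, hp⟩ c hc hvc
    refine hc (.inl ⟨a, ha, p.concat hvc, fun b hb hb' => ?_⟩)
    rw [SimpleGraph.Walk.support_concat, List.mem_append, List.mem_singleton] at hb'
    exact hb'.elim (hp b hb) fun hbc => hc (.inr (hbc ▸ hb))

variable {m : V} {κ : T.Dart → Kernel ℝ ℝ} {μ : Measure (V → ℝ)} [IsFiniteMeasure μ]

theorem IsSeparatedTriple.condIndepFun_of_union_eq_singleton [Countable V]
    (h : IsSeparatedTriple G A B C) (hU : A ∪ B ∪ C = {m}) :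
    A.indicator ⟂ᵢ[B.indicator, measurable_indicator B; μ] C.indicator := by
  have hempty : (∅ : Set V).indicator = fun _ : V → ℝ => 0 := funext Set.indicator_empty
  have hAC : A = ∅ ∨ C = ∅ := by
    by_contra! hne
    obtain ⟨⟨a, ha⟩, c, hc⟩ := hne
    have ham : a = m := hU.subset (.inl (.inl ha))
    have hcm : c = m := hU.subset (.inr hc)
    exact Set.disjoint_left.1 h.disjoint ha (ham ▸ hcm ▸ hc)
  rcases hAC with rfl | rfl
  · rw [hempty]
    exact condIndepFun_const_left 0 _
  · rw [hempty]
    exact condIndepFun_const_right _ 0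

variable [∀ e, IsMarkovKernel (κ e)] [Finite V]

theorem IsTreeMarkovChain.condIndepFun_of_isSeparatedTriple (hT : T.IsTree)
    (h : IsTreeMarkovChain T m κ μ) {S : Set V} (hS : IsRootedSubtree T m S) (hU : A ∪ B ∪ C = S)
    (hABC : IsSeparatedTriple T A B C) :
    A.indicator ⟂ᵢ[B.indicator, measurable_indicator B; μ] C.indicator := by
  revert A B C
  refine IsRootedSubtree.induction hT (motive := fun S => ∀ {A B C : Set V}, A ∪ B ∪ C = S →
    IsSeparatedTriple T A B C → A.indicator ⟂ᵢ[B.indicator, measurable_indicator B; μ]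
      C.indicator) ?_ ?_ hS
  · exact fun hU hABC => hABC.condIndepFun_of_union_eq_singleton hU
  · intro S hS e he hfst hsnd ih
    have hleft {A B C : Set V} (hU : A ∪ B ∪ C = insert e.snd S) (hABC : IsSeparatedTriple T A B C)
        (hA : e.snd ∈ A) :
        A.indicator ⟂ᵢ[B.indicator, measurable_indicator B; μ] C.indicator := by
      have hB := Set.disjoint_left.1 hABC.disjoint_left hA
      have hC := Set.disjoint_left.1 hABC.disjoint hA
      have hS_eq : A \ {e.snd} ∪ B ∪ C = S := by grind
      have hfstC : e.fst ∉ C := fun h => hABC.not_adj _ hA _ h e.adj.symm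
      have hCI := h.condIndepFun_insert_left hS he hfst hsnd (by grind) (by grind) (by grind)
        (by grind) (ih hS_eq (hABC.mono Set.sdiff_subset subset_rfl subset_rfl))
      rwa [Set.insert_sdiff_singleton, Set.insert_eq_of_mem hA] at hCI
    have hmiddle {A B C : Set V} (hU : A ∪ B ∪ C = insert e.snd S)
        (hABC : IsSeparatedTriple T A B C) (hB : e.snd ∈ B) (hAB : e.fst ∈ A ∪ B) :
        A.indicator ⟂ᵢ[B.indicator, measurable_indicator B; μ] C.indicator := by
      have hA := Set.disjoint_right.1 hABC.disjoint_left hB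
      have hC := Set.disjoint_left.1 hABC.disjoint_right hB
      have hS_eq : A ∪ B \ {e.snd} ∪ C = S := by grind
      have hCI := h.condIndepFun_insert_middle hS he hfst hsnd (by grind) (by grind) (by grind)
        (by grind) (ih hS_eq (hABC.mono subset_rfl Set.sdiff_subset subset_rfl))
      simpa only [Set.insert_sdiff_singleton, Set.insert_eq_of_mem hB] using hCI
    intro A B C hU hABC
    have hU' : C ∪ B ∪ A = insert e.snd S := by rw [← hU]; ac_rfl
    have hsnd' : e.snd ∈ A ∪ B ∪ C := hU ▸ Set.mem_insert _ _
    have hfst' : e.fst ∈ A ∪ B ∪ C := hU ▸ Set.mem_insert_of_mem _ hfst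
    rcases hsnd' with (hA | hB) | hC
    · exact hleft hU hABC hA
    · rcases hfst' with hAB | hC
      · exact hmiddle hU hABC hB hAB
      · exact (hmiddle hU' hABC.symm hB (.inl hC)).symm
    · exact (hleft hU' hABC.symm hC).symm

theorem IsTreeMarkovChain.condIndepFun_of_separates (hT : T.IsTree)
    (h : IsTreeMarkovChain T m κ μ) (hAB : Disjoint A B) (hBC : Disjoint B C)
    (hsep : Separates T A B C) :
    (fun (y : V → ℝ) (a : A) => y a) ⟂ᵢ[fun (y : V → ℝ) (b : B) => y b, (by fun_prop); μ]
      fun (y : V → ℝ) (c : C) => y c := by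
  classical
  obtain ⟨A', C', hA, hC, hU, hABC⟩ := hsep.exists_isSeparatedTriple hAB hBC
  have hrestrict := condIndepFun_comp_prodMk (measurable_indicator C') (measurable_indicator A')
    (measurable_indicator B) (h.condIndepFun_of_isSeparatedTriple hT (.univ T m) hU hABC)
    (f := fun x (c : C) => x c) (by fun_prop) (g := fun p (a : A) => p.2 a) (by fun_prop)
    (k := fun p (b : B) => p.1 b) (by fun_prop)
    (l := fun b v => if hv : v ∈ B then b ⟨v, hv⟩ else 0)
    (measurable_pi_lambda _ fun v => by split_ifs <;> fun_prop)
    fun y => by ext v; by_cases hv : v ∈ B <;> simp [hv]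
  simpa only [Set.indicator_of_mem (Subtype.prop _), Set.indicator_of_mem (hA (Subtype.prop _)),
    Set.indicator_of_mem (hC (Subtype.prop _))] using hrestrict

end GlobalMarkov

section MulKernel

variable {Ω γ : Type*} [MeasurableSpace Ω] [MeasurableSpace γ] (κ : Measure ℝ)

/-- The transition kernel of multiplication by an independent random variable of law `κ`: from `r`,
move to `r * U` with `U ∼ κ`. -/
noncomputable def mulKernel : Kernel ℝ ℝ :=
  (Kernel.id ×ₖ Kernel.const ℝ κ).map fun p => p.1 * p.2

theorem mulKernel_apply [SFinite κ] (r : ℝ) : mulKernel κ r = κ.map (r * ·) := by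
  rw [mulKernel, Kernel.map_apply _ (by fun_prop), Kernel.prod_apply, Kernel.id_apply,
    Kernel.const_apply, Measure.dirac_prod, Measure.map_map (by fun_prop) (by fun_prop)]
  rfl

instance [IsProbabilityMeasure κ] : IsMarkovKernel (mulKernel κ) :=
  Kernel.IsMarkovKernel.map _ (by fun_prop)

variable {κ}

theorem hasCondDistrib_mul [IsProbabilityMeasure κ] {Q : Measure Ω} [SFinite Q] {Z : Ω → γ}
    {U : Ω → ℝ} (hZ : Measurable Z) (hU : Measurable U)
    (h : Q.map (fun ω => (Z ω, U ω)) = (Q.map Z).prod κ) {g : γ → ℝ} (hg : Measurable g) :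
    HasCondDistrib (fun ω => g (Z ω) * U ω) Z ((mulKernel κ).comap g hg) Q := by
  refine ⟨by fun_prop, Measure.ext fun s hs => ?_⟩
  have hmul : Measurable fun p : γ × ℝ => (p.1, g p.1 * p.2) := by fun_prop
  have hcomp : (fun ω => (Z ω, g (Z ω) * U ω)) =
      (fun p => (p.1, g p.1 * p.2)) ∘ fun ω => (Z ω, U ω) := rfl
  rw [hcomp, ← Measure.map_map hmul (hZ.prodMk hU), h, Measure.map_apply hmul hs,
    Measure.prod_apply (hmul hs), Measure.compProd_apply hs]
  refine lintegral_congr fun z => ?_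
  rw [Kernel.comap_apply, mulKernel_apply, Measure.map_apply (by fun_prop)
    (measurable_prodMk_left hs)]
  rfl

end MulKernel

section TreeMeasureChain

variable {V : Type*} {T : SimpleGraph V} (hT : T.IsTree)

theorem indicator_treeVec_update [DecidableEq T.Dart] {m : V} {S : Set V}
    (hS : IsRootedSubtree T m S) {e : T.Dart} (hsnd : e.snd ∉ S) (r u : ℝ) (w : T.Dart → ℝ) :
    S.indicator (treeVec hT m (r, Function.update w e u)) =
      S.indicator (treeVec hT m (r, w)) := by
  refine Set.indicator_congr fun v hv => ?_
  refine congrArg (r * ·) (pathProduct_congr hT fun d hd => Function.update_of_ne ?_ _ _)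
  rintro rfl
  exact hsnd (hS.mem_of_mem_support hT hv
    (SimpleGraph.Walk.dart_snd_mem_support_of_mem_darts _ hd))

variable [Fintype T.Dart] {ρ : Measure ℝ} [SFinite ρ] {ν : T.Dart → Measure ℝ}
  [∀ e, IsProbabilityMeasure (ν e)]

theorem map_indicator_treeVec_prodMk {m : V} {S : Set V} (hS : IsRootedSubtree T m S)
    {e : T.Dart} (hsnd : e.snd ∉ S) :
    (ρ.prod (Measure.pi ν)).map (fun q => (S.indicator (treeVec hT m q), q.2 e)) =
      ((ρ.prod (Measure.pi ν)).map fun q => S.indicator (treeVec hT m q)).prod (ν e) := by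
  classical
  have hind : Measurable fun q => S.indicator (treeVec hT m q) :=
    (measurable_indicator S).comp (measurable_treeVec hT m)
  have hrearrange := (measurePreserving_prodAssoc ρ (Measure.pi ν) (ν e)).symm.comp
    ((MeasurePreserving.id ρ).prod (Measure.measurePreserving_swap (μ := ν e) (ν := Measure.pi ν)))
  have hresample : MeasurePreserving
      (Prod.map id fun p : ℝ × (T.Dart → ℝ) => Function.update p.2 e p.1)
      (ρ.prod ((ν e).prod (Measure.pi ν))) (ρ.prod (Measure.pi ν)) :=
    (MeasurePreserving.id ρ).prod ⟨measurable_update_snd_fst (α := fun _ : T.Dart => ℝ) e,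
      map_update_prod_pi ν e⟩
  have hmap := Measure.map_prod_map (ρ.prod (Measure.pi ν)) (ν e) hind measurable_id
  rw [Measure.map_id] at hmap
  rw [hmap, ← hrearrange.map_eq, ← hresample.map_eq, Measure.map_map (by fun_prop) (by fun_prop),
    Measure.map_map (by fun_prop) (by fun_prop)]
  refine congrArg (Measure.map · _) (funext fun p => Prod.ext ?_ (Function.update_self e _ _))
  exact indicator_treeVec_update hT hS hsnd p.1 p.2.1 p.2.2

theorem isTreeMarkovChain_treeMeasure (m : V) :
    IsTreeMarkovChain T m (fun e => mulKernel (ν e)) (treeMeasure hT m ρ ν) := by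
  intro S hS e he hfst hsnd
  have hind : Measurable fun q => S.indicator (treeVec hT m q) :=
    (measurable_indicator S).comp (measurable_treeVec hT m)
  have hmul := hasCondDistrib_mul hind (U := fun q => q.2 e) (by fun_prop)
    (map_indicator_treeVec_prodMk hT (ρ := ρ) (ν := ν) hS hsnd) (measurable_pi_apply e.fst)
  simp only [Set.indicator_of_mem hfst, ← treeVec_snd hT he] at hmul
  refine ⟨by fun_prop, ?_⟩
  rw [treeMeasure_eq_map_treeVec, Measure.map_map (by fun_prop) (by fun_prop),
    Measure.map_map (by fun_prop) (by fun_prop)]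
  exact hmul.map_eq

end TreeMeasureChain

section ExtremalFunction

variable {V : Type*} {Λ μ : Measure (V → ℝ)} {m : V} {ν : Measure (V → ℝ)}

theorem measurable_inv_apply_smul (m : V) : Measurable fun x : V → ℝ => (x m)⁻¹ • x :=
  measurable_pi_lambda _ fun i => (measurable_pi_apply m).inv.mul (measurable_pi_apply i)

namespace IsExtremalFunction

theorem smul_ae_eq (h : IsExtremalFunction μ m ν) :
    (fun q : ℝ × (V → ℝ) => (q.1 • q.2) m) =ᵐ[stdPareto.prod ν] Prod.fst := by
  filter_upwards [Measure.quasiMeasurePreserving_snd.ae h.ae_eq_one] with q hq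
  simp [hq]

theorem eq_map_inv_smul (h : IsExtremalFunction μ m ν) :
    ν = (exceedanceLaw μ m).map fun x => (x m)⁻¹ • x := by
  have := h.isProbabilityMeasure
  have hsnd : (fun x : V → ℝ => (x m)⁻¹ • x) ∘ (fun q : ℝ × (V → ℝ) => q.1 • q.2)
      =ᵐ[stdPareto.prod ν] Prod.snd := by
    filter_upwards [h.smul_ae_eq, Measure.quasiMeasurePreserving_fst.ae ae_stdPareto_one_lt]
      with q hq hr
    simp only [Function.comp_apply, hq, smul_smul, inv_mul_cancel₀ (one_pos.trans hr).ne',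
      one_smul]
  rw [h.exceedanceLaw_eq, paretoMixture,
    Measure.map_map (measurable_inv_apply_smul m) measurable_fst_smul_snd, Measure.map_congr hsnd,
    Measure.map_snd_prod, measure_univ, one_smul]

theorem isProbabilityMeasure_map_eval (h : IsExtremalFunction μ m ν) (j : V) :
    IsProbabilityMeasure (ν.map (Function.eval j)) :=
  have := h.isProbabilityMeasure
  Measure.isProbabilityMeasure_map (measurable_pi_apply j).aemeasurable

theorem map_eval (h : IsExtremalFunction μ m ν) :
    (exceedanceLaw μ m).map (Function.eval m) = stdPareto := by
  have := h.isProbabilityMeasure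
  rw [h.exceedanceLaw_eq, paretoMixture, Measure.map_map (by fun_prop) measurable_fst_smul_snd]
  exact (Measure.map_congr h.smul_ae_eq).trans (by simp)

theorem hasCondDistrib (h : IsExtremalFunction μ m ν) (j : V) :
    HasCondDistrib (Function.eval j) (Function.eval m) (mulKernel (ν.map (Function.eval j)))
      (exceedanceLaw μ m) := by
  have := h.isProbabilityMeasure
  have := h.isProbabilityMeasure_map_eval j
  have hprod := Measure.map_prod_map stdPareto ν measurable_id (measurable_pi_apply j)
  rw [Measure.map_id] at hprod
  have hmul := hasCondDistrib_mul (Q := stdPareto.prod ν) (Z := Prod.fst) (U := fun q => q.2 j)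
    (κ := ν.map (Function.eval j)) measurable_fst (by fun_prop)
    (by rw [Measure.map_fst_prod, measure_univ, one_smul]; exact hprod.symm)
    (g := id) measurable_id
  refine ⟨by fun_prop, ?_⟩
  rw [h.map_eval, h.exceedanceLaw_eq, paretoMixture, Measure.map_map (by fun_prop)
    measurable_fst_smul_snd, Measure.map_congr (g := fun q => (q.1, q.1 * q.2 j))]
  · refine hmul.map_eq.trans ?_
    simp [Kernel.comap_id]
  · filter_upwards [h.smul_ae_eq] with q hq using Prod.ext hq rfl

end IsExtremalFunction

theorem IsExponentMeasure.isExtremalFunction [Finite V] (h : IsExponentMeasure Λ) (m : V) :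
    IsExtremalFunction (cond Λ (paretoSupport V)) m
      ((Λ.restrict {x | 1 < x m}).map fun x => (x m)⁻¹ • x) := by
  have := h.isProbabilityMeasure_restrict m
  have hprofile := (measurable_inv_apply_smul m).aemeasurable (μ := Λ.restrict {x | 1 < x m})
  have hone : ∀ᵐ x ∂Λ.restrict {x | 1 < x m}, 1 < x m :=
    ae_restrict_mem (measurableSet_lt_apply 1 m)
  refine ⟨Measure.isProbabilityMeasure_map hprofile, ?_, ?_, ?_⟩
  · refine (ae_map_iff hprofile (by measurability)).2 ?_
    filter_upwards [ae_restrict_of_ae h.ae_nonneg] with x hx i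
    exact mul_nonneg (inv_nonneg.2 (hx m)) (hx i)
  · refine (ae_map_iff hprofile (measurable_pi_apply m (measurableSet_singleton 1))).2 ?_
    filter_upwards [hone] with x hx using inv_mul_cancel₀ (one_pos.trans hx).ne'
  · rw [h.exceedanceLaw_cond]
    refine eq_paretoMixture_map_inv_smul (measurable_pi_apply m) (fun _ _ _ => rfl) hone
      fun t ht => ?_
    have hsub : {x : V → ℝ | t < x m} ⊆ {x | 1 < x m} := fun x hx => ht.trans_lt hx
    rw [← h.restrict_lt_apply_eq_smul_map (one_pos.trans_le ht),
      Measure.restrict_restrict_of_subset hsub]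

theorem IsMultivariatePareto.existsUnique_isExtremalFunction [Finite V]
    (h : IsMultivariatePareto μ) (m : V) : ∃! ν, IsExtremalFunction μ m ν := by
  obtain ⟨Λ, hΛ, rfl⟩ := h.exists_isExponentMeasure
  exact ⟨_, hΛ.isExtremalFunction m, fun ν hν => by
    rw [hν.eq_map_inv_smul, hΛ.exceedanceLaw_cond]⟩

end ExtremalFunction

section MulKernelScaling

variable {κ : Measure ℝ} [IsProbabilityMeasure κ]

theorem mulKernel_comap_mul_left (t : ℝ) :
    (mulKernel κ).comap (t * ·) (measurable_const_mul t) = (mulKernel κ).map (t * ·) := by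
  ext r : 1
  rw [Kernel.comap_apply, Kernel.map_apply _ (measurable_const_mul t), mulKernel_apply,
    mulKernel_apply, Measure.map_map (by fun_prop) (by fun_prop)]
  exact congrArg (κ.map ·) (funext fun u => mul_assoc t r u)

theorem hasCondDistrib_mulKernel_of_ae_eq_zero {Ω : Type*} [MeasurableSpace Ω] {μ : Measure Ω}
    [SFinite μ] {X Z : Ω → ℝ} (hX : X =ᵐ[μ] 0) (hZ : Z =ᵐ[μ] 0) :
    HasCondDistrib X Z (mulKernel κ) μ := by
  have hpair : (fun ω => (Z ω, X ω)) =ᵐ[μ] fun _ => (0, 0) := by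
    filter_upwards [hX, hZ] with ω hXω hZω using Prod.ext hZω hXω
  have hker : mulKernel κ 0 = Measure.dirac 0 := by
    simp [mulKernel_apply]
  have hdirac : Measure.dirac 0 ⊗ₘ mulKernel κ = Measure.dirac (0, 0) := by
    ext s hs
    rw [Measure.dirac_compProd_apply hs, hker, Measure.dirac_apply' _ hs,
      Measure.dirac_apply' _ (measurable_prodMk_left hs)]
    rfl
  refine ⟨measurable_const.aemeasurable.congr hpair.symm, ?_⟩
  rw [Measure.map_congr hpair, Measure.map_congr (g := fun _ => 0) hZ, Measure.map_const,
    Measure.map_const, Measure.compProd_smul_left, hdirac]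

end MulKernelScaling

section Propagation

variable {V : Type*} {κ : Measure ℝ} [IsProbabilityMeasure κ] {Λ : Measure (V → ℝ)} {i j m : V}

theorem hasCondDistrib_eval_map_smul {ρ : Measure (V → ℝ)} [SFinite ρ]
    (h : HasCondDistrib (Function.eval j) (Function.eval i) (mulKernel κ) ρ) (t : ℝ) :
    HasCondDistrib (Function.eval j) (Function.eval i) (mulKernel κ) (ρ.map (t • ·)) := by
  have hscaled := h.comp_left (measurable_const_mul t)
  rw [← mulKernel_comap_mul_left] at hscaled
  refine ⟨by fun_prop, ?_⟩
  rw [Measure.map_map (by fun_prop) (by fun_prop), Measure.map_map (by fun_prop) (by fun_prop)]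
  exact hscaled.comp_right.map_eq

namespace IsExponentMeasure

variable (h : IsExponentMeasure Λ)

include h

theorem measure_eq_zero_and_lt_eq_ofReal_mul {r u t : ℝ} (ht : 0 < t) :
    Λ {x | x i = 0 ∧ r < x m ∧ u < x j} =
      ENNReal.ofReal t * Λ {x | x i = 0 ∧ t * r < x m ∧ t * u < x j} := by
  have hpre : (t • ·) ⁻¹' {x : V → ℝ | x i = 0 ∧ t * r < x m ∧ t * u < x j} =
      {x | x i = 0 ∧ r < x m ∧ u < x j} := by
    ext x
    simp [ht, ht.ne']
  rw [← h.measure_preimage_smul ht (by measurability), hpre]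

variable [Countable V]

theorem hasCondDistrib_restrict_lt_apply
    (hij : HasCondDistrib (Function.eval j) (Function.eval i) (mulKernel κ)
      (Λ.restrict {x | 1 < x i})) [IsFiniteMeasure (Λ.restrict {x | 1 < x i})]
    (hCI : Function.eval m ⟂ᵢ[Function.eval i, measurable_pi_apply i;
      Λ.restrict {x | 1 < x i}] Function.eval j) {s : ℝ} (hs : 0 < s) :
    HasCondDistrib (Function.eval j) (Function.eval i) (mulKernel κ)
      ((Λ.restrict {x | 1 < x m}).restrict (Function.eval i ⁻¹' Set.Ioi s)) := by
  have hpair : HasCondDistrib (Function.eval j) (fun x : V → ℝ => (x i, x m))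
      ((mulKernel κ).prodMkRight ℝ) (Λ.restrict {x | 1 < x i}) :=
    hasCondDistrib_prodMk_of_condIndepFun (measurable_pi_apply m) (measurable_pi_apply i)
      (measurable_pi_apply j) hij hCI
  have hB : MeasurableSet {p : ℝ × ℝ | s⁻¹ < p.2} := measurableSet_lt (by fun_prop) (by fun_prop)
  have hrestrict := hasCondDistrib_restrict_preimage hpair (measurable_pi_apply j) (by fun_prop) hB
  have hi : MeasurableSet (Function.eval i ⁻¹' Set.Ioi s : Set (V → ℝ)) :=
    measurable_pi_apply i measurableSet_Ioi
  have hpre : (s • ·) ⁻¹' (Function.eval i ⁻¹' Set.Ioi s ∩ {x : V → ℝ | 1 < x m}) =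
      (fun x => (x i, x m)) ⁻¹' {p : ℝ × ℝ | s⁻¹ < p.2} ∩ {x | 1 < x i} := by
    ext x
    simp [hs, inv_lt_iff_one_lt_mul₀', and_comm]
  rw [Measure.restrict_restrict hi,
    h.restrict_eq_smul_map hs (hi.inter (measurableSet_lt_apply 1 m)), hpre,
    ← Measure.restrict_restrict (hB.preimage (by fun_prop))]
  exact hasCondDistrib_smul_measure (hasCondDistrib_eval_map_smul
    (hrestrict.comp_right (hf := measurable_fst)) s) _

theorem measure_eq_zero_and_lt_eq_ofReal_mul_of_condIndepFun
    [IsFiniteMeasure (Λ.restrict {x | 1 < x j})]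
    (hCI : Function.eval m ⟂ᵢ[Function.eval i, measurable_pi_apply i;
      Λ.restrict {x | 1 < x j}] Function.eval j) (r : ℝ) {t : ℝ} (ht : 1 ≤ t) :
    Λ {x | x i = 0 ∧ r < x m ∧ 1 < x j} =
      ENNReal.ofReal t * Λ {x | x i = 0 ∧ r < x m ∧ t < x j} := by
  have ht0 : 0 < t := one_pos.trans_le ht
  let g (u : ℝ) : ℝ≥0∞ := Λ {x | x i = 0 ∧ u < x j}
  have hg : g 1 = ENNReal.ofReal t * g t := by
    simpa only [mul_one, and_self] using
      h.measure_eq_zero_and_lt_eq_ofReal_mul (i := i) (m := j) (j := j) (r := 1) (u := 1) ht0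
  have hg_top : g t ≠ ∞ := by
    have hsub : {x | x i = 0 ∧ t < x j} ⊆ {x : V → ℝ | 1 < x j} := fun x hx => ht.trans_lt hx.2
    refine ((measure_mono hsub).trans_lt ?_).ne
    simpa using measure_lt_top (Λ.restrict {x | 1 < x j}) .univ
  have hfiber := measure_fiber_inter_mul_of_condIndepFun (measurable_pi_apply j)
    (measurable_pi_apply m) (measurable_pi_apply i) hCI 0 (measurableSet_Ioi (a := r))
    (measurableSet_Ioi (a := t))
  simp only [Measure.restrict_apply' (measurableSet_lt_apply 1 j), Set.inter_assoc] at hfiber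
  have hlt : Function.eval j ⁻¹' Set.Ioi t ∩ {x : V → ℝ | 1 < x j} = {x | t < x j} :=
    Set.inter_eq_left.2 fun x hx => ht.trans_lt hx
  rw [hlt] at hfiber
  change Λ {x | x i = 0 ∧ r < x m ∧ t < x j} * g 1 =
    Λ {x | x i = 0 ∧ r < x m ∧ 1 < x j} * g t at hfiber
  by_cases hg0 : g t = 0
  · rw [hg0, mul_zero] at hg
    have hsub (u : ℝ) : {x : V → ℝ | x i = 0 ∧ r < x m ∧ u < x j} ⊆ {x | x i = 0 ∧ u < x j} :=
      fun x hx => ⟨hx.1, hx.2.2⟩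
    rw [measure_mono_null (hsub 1) hg, measure_mono_null (hsub t) hg0, mul_zero]
  · rw [hg, mul_left_comm, ← mul_assoc] at hfiber
    exact ((ENNReal.mul_left_inj hg0 hg_top).1 hfiber).symm

-- By independence and homogeneity, `Λ {x i = 0, r < x m, 1 < x j}` does not change when `r` is
-- replaced by `t * r`, whereas `Λ {t * r < x m}` vanishes in the limit `t → ∞`.
theorem measure_eq_zero_and_lt_eq_zero_of_condIndepFun [IsFiniteMeasure (Λ.restrict {x | 1 < x j})]
    (hCI : Function.eval m ⟂ᵢ[Function.eval i, measurable_pi_apply i;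
      Λ.restrict {x | 1 < x j}] Function.eval j) {r : ℝ} (hr : 0 < r) :
    Λ {x | x i = 0 ∧ r < x m ∧ 1 < x j} = 0 := by
  have hbound {t : ℝ} (ht : 1 ≤ t) :
      Λ {x | x i = 0 ∧ r < x m ∧ 1 < x j} ≤ (ENNReal.ofReal (t * r))⁻¹ := by
    have ht0 : 0 < t := one_pos.trans_le ht
    rw [h.measure_eq_zero_and_lt_eq_ofReal_mul ht0, mul_one,
      ← h.measure_eq_zero_and_lt_eq_ofReal_mul_of_condIndepFun hCI _ ht,
      ← h.measure_lt_apply (mul_pos ht0 hr) m]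
    exact measure_mono fun x hx => hx.2.1
  have hlim : Filter.Tendsto (fun t : ℝ => (ENNReal.ofReal (t * r))⁻¹) Filter.atTop (nhds 0) := by
    simpa using (ENNReal.tendsto_ofReal_atTop.comp (Filter.tendsto_id.atTop_mul_const hr)).inv
  exact le_zero_iff.1 (ge_of_tendsto hlim ((Filter.eventually_ge_atTop 1).mono fun t => hbound))

theorem ae_restrict_apply_eq_zero_of_condIndepFun [IsFiniteMeasure (Λ.restrict {x | 1 < x j})]
    (hCI : Function.eval m ⟂ᵢ[Function.eval i, measurable_pi_apply i;
      Λ.restrict {x | 1 < x j}] Function.eval j) :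
    ∀ᵐ x ∂Λ.restrict {x | 1 < x m}, x i = 0 → x j = 0 := by
  have hnull (n : ℕ) : ∀ᵐ x ∂Λ, ¬(x i = 0 ∧ 1 < x m ∧ 1 / ((n : ℝ) + 1) < x j) := by
    have hn : (0 : ℝ) < n + 1 := by positivity
    refine measure_eq_zero_iff_ae_notMem.1 (?_ : Λ {x | _ ∧ _ ∧ _} = 0)
    rw [h.measure_eq_zero_and_lt_eq_ofReal_mul hn, mul_one_div_cancel hn.ne',
      h.measure_eq_zero_and_lt_eq_zero_of_condIndepFun hCI (by positivity), mul_zero]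
  filter_upwards [ae_restrict_mem (measurableSet_lt_apply 1 m), ae_restrict_of_ae h.ae_nonneg,
    ae_restrict_of_ae (ae_all_iff.2 hnull)] with x hm hnonneg hx hi
  by_contra hj
  obtain ⟨n, hn⟩ := exists_nat_one_div_lt ((hnonneg j).lt_of_ne' hj)
  exact hx n ⟨hi, hm, hn⟩

theorem hasCondDistrib_eval_of_condIndepFun
    (hij : HasCondDistrib (Function.eval j) (Function.eval i) (mulKernel κ)
      (Λ.restrict {x | 1 < x i})) [IsFiniteMeasure (Λ.restrict {x | 1 < x i})]
    [IsFiniteMeasure (Λ.restrict {x | 1 < x j})]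
    (hCIi : Function.eval m ⟂ᵢ[Function.eval i, measurable_pi_apply i;
      Λ.restrict {x | 1 < x i}] Function.eval j)
    (hCIj : Function.eval m ⟂ᵢ[Function.eval i, measurable_pi_apply i;
      Λ.restrict {x | 1 < x j}] Function.eval j) :
    HasCondDistrib (Function.eval j) (Function.eval i) (mulKernel κ)
      (Λ.restrict {x | 1 < x m}) := by
  have := h.isFiniteMeasure_restrict one_pos m
  let B : Option ℕ → Set ℝ := fun o => o.elim (Set.Iic 0) fun n => Set.Ioi (1 / ((n : ℝ) + 1))
  have hB_univ : ⋃ o, B o = Set.univ := by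
    refine Set.eq_univ_of_forall fun r => Set.mem_iUnion.2 ?_
    rcases le_or_gt r 0 with hr | hr
    · exact ⟨none, hr⟩
    · exact (exists_nat_one_div_lt hr).imp' some fun _ hn => hn
  refine hasCondDistrib_of_forall_restrict_preimage (B := B) (measurable_pi_apply j)
    (measurable_pi_apply i) (Option.forall.2 ⟨measurableSet_Iic, fun _ => measurableSet_Ioi⟩)
    hB_univ (Option.forall.2 ⟨?_, fun n => ?_⟩)
  · have hzero : Function.eval i =ᵐ[(Λ.restrict {x | 1 < x m}).restrict
        (Function.eval i ⁻¹' Set.Iic 0)] 0 := by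
      filter_upwards [ae_restrict_mem (measurable_pi_apply i measurableSet_Iic),
        ae_restrict_of_ae (ae_restrict_of_ae h.ae_nonneg)] with x hx hnonneg
      exact le_antisymm hx (hnonneg i)
    refine hasCondDistrib_mulKernel_of_ae_eq_zero ?_ hzero
    filter_upwards [hzero,
      ae_restrict_of_ae (h.ae_restrict_apply_eq_zero_of_condIndepFun hCIj)] with x hi hx
    exact hx hi
  · exact h.hasCondDistrib_restrict_lt_apply hij hCIi Nat.one_div_pos_of_nat

end IsExponentMeasure

end Propagation

section Representation

variable {V : Type*} [Fintype V] {T : SimpleGraph V} {μ : Measure (V → ℝ)}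

theorem IsExtremalGraphicalModel.condIndepFun_edge (hG : IsExtremalGraphicalModel T μ)
    (hT : T.IsTree) {m : V} {S : Set V} (hS : IsRootedSubtree T m S) {e : T.Dart}
    (hfst : e.fst ∈ S) (hsnd : e.snd ∉ S) (k : V) :
    S.indicator ⟂ᵢ[Function.eval e.fst, measurable_pi_apply _; exceedanceLaw μ k]
      Function.eval e.snd := by
  classical
  have hsep : Separates T {e.snd} {e.fst} (S \ {e.fst}) := by
    rintro _ rfl c hc p hp
    exact ⟨e.fst, rfl, hS.fst_mem_support hT hfst hsnd hc.1 hp⟩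
  have hsubvectors := hG {e.snd} {e.fst} (S \ {e.fst}) (by simp)
    Set.disjoint_sdiff_right (Set.disjoint_singleton_left.2 fun h => hsnd h.1) hsep k
  have hindicator (x : V → ℝ) (v : V) : S.indicator x v =
      if _ : v ∈ S \ {e.fst} then x v else if v = e.fst then x e.fst else 0 := by
    by_cases hvS : v ∈ S <;> by_cases hve : v = e.fst <;> simp_all
  have := condIndepFun_comp_prodMk (by fun_prop) (by fun_prop) (by fun_prop) hsubvectors.symm
    (f := fun z => z ⟨e.snd, rfl⟩) (by fun_prop)
    (g := fun p v => if hv : v ∈ S \ {e.fst} then p.2 ⟨v, hv⟩ else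
      if v = e.fst then p.1 ⟨e.fst, rfl⟩ else 0)
    (measurable_pi_lambda _ fun v => by split_ifs <;> fun_prop)
    (k := fun p => p.1 ⟨e.fst, rfl⟩) (by fun_prop) (l := fun r _ => r) (by fun_prop)
    fun x => funext fun b => by rw [Set.mem_singleton_iff.1 b.2]
  simp only [← hindicator] at this
  exact this

variable {ν : V → Measure (V → ℝ)} (hμ : IsMultivariatePareto μ)
  (hG : IsExtremalGraphicalModel T μ) (hT : T.IsTree) (hν : ∀ i, IsExtremalFunction μ i (ν i))

include hμ hG hT hν

theorem hasCondDistrib_edge {m : V} {S : Set V} (hS : IsRootedSubtree T m S) {e : T.Dart}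
    (hfst : e.fst ∈ S) (hsnd : e.snd ∉ S) :
    HasCondDistrib (Function.eval e.snd) (Function.eval e.fst)
      (mulKernel ((ν e.fst).map (Function.eval e.snd))) (exceedanceLaw μ m) := by
  have := (hν e.fst).isProbabilityMeasure_map_eval e.snd
  have hroot (k : V) : Function.eval m ⟂ᵢ[Function.eval e.fst, measurable_pi_apply _;
      exceedanceLaw μ k] Function.eval e.snd := by
    have := (hG.condIndepFun_edge hT hS hfst hsnd k).comp (measurable_pi_apply m) measurable_id
    have heval : Function.eval m ∘ S.indicator = (Function.eval m : (V → ℝ) → ℝ) :=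
      funext fun x => Set.indicator_of_mem hS.root_mem x
    rwa [heval] at this
  have hedge := (hν e.fst).hasCondDistrib e.snd
  obtain ⟨Λ, hΛ, rfl⟩ := hμ.exists_isExponentMeasure
  have := hΛ.isProbabilityMeasure_restrict
  simp only [hΛ.exceedanceLaw_cond] at hroot hedge ⊢
  exact hΛ.hasCondDistrib_eval_of_condIndepFun hedge (hroot e.fst) (hroot e.snd)

theorem isTreeMarkovChain_exceedanceLaw (m : V) :
    IsTreeMarkovChain T m (fun e => mulKernel ((ν e.fst).map (Function.eval e.snd)))
      (exceedanceLaw μ m) := by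
  intro S hS e _ hfst hsnd
  have := (hν e.fst).isProbabilityMeasure_map_eval e.snd
  have hpair := hasCondDistrib_prodMk_of_condIndepFun (measurable_indicator S)
    (measurable_pi_apply e.fst) (measurable_pi_apply e.snd)
    (hasCondDistrib_edge hμ hG hT hν hS hfst hsnd) (hG.condIndepFun_edge hT hS hfst hsnd m)
  have hcomap : HasCondDistrib (Function.eval e.snd) (fun x => (x e.fst, S.indicator x))
      (((mulKernel ((ν e.fst).map (Function.eval e.snd))).comap (Function.eval e.fst)
        (measurable_pi_apply _)).comap Prod.snd measurable_snd) (exceedanceLaw μ m) :=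
    hasCondDistrib_congr hpair <| .of_forall fun x => by
      simp only [Kernel.prodMkRight_apply, Kernel.comap_apply, Function.eval,
        Set.indicator_of_mem hfst]
  exact hcomap.comp_right

theorem exceedanceLaw_eq_treeMeasure [Fintype T.Dart] (m : V) :
    exceedanceLaw μ m =
      treeMeasure hT m stdPareto fun e => (ν e.fst).map (Function.eval e.snd) := by
  have hprob (e : T.Dart) := (hν e.fst).isProbabilityMeasure_map_eval e.snd
  refine (isTreeMarkovChain_exceedanceLaw hμ hG hT hν m).ext hT
    (isTreeMarkovChain_treeMeasure hT m) ?_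
  rw [(hν m).map_eval, treeMeasure_eq_map_treeVec, Measure.map_map (by fun_prop) (by fun_prop)]
  simp only [Function.comp_def, Function.eval, treeVec_root]
  rw [Measure.map_fst_prod, measure_univ, one_smul]

end Representation

section OutwardEdges

theorem measurePreserving_pi_subtype {ι : Type*} [Fintype ι] {α : ι → Type*}
    [∀ i, MeasurableSpace (α i)] (μ : ∀ i, Measure (α i)) [∀ i, IsProbabilityMeasure (μ i)]
    (s : Set ι) [Fintype s] :
    MeasurePreserving (fun (w : ∀ i, α i) (i : s) => w i) (Measure.pi μ)
      (Measure.pi fun i : s => μ i) := by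
  have hindep : iIndepFun (fun (i : s) (w : ∀ i, α i) => w i) (Measure.pi μ) :=
    (iIndepFun_pi (X := fun _ => id) fun _ => aemeasurable_id).precomp Subtype.val_injective
  refine ⟨by fun_prop, ?_⟩
  rw [hindep.map_fun_eq_pi_map fun i => (measurable_pi_apply _).aemeasurable]
  exact congrArg Measure.pi (funext fun i => (measurePreserving_eval μ i.1).map_eq)

theorem measurable_extend_zero {ι : Type*} (s : Set ι) :
    Measurable fun w : s → ℝ => Function.extend Subtype.val w 0 := by
  refine measurable_pi_lambda _ fun i => ?_
  by_cases hi : i ∈ s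
  · simpa only [Function.extend_val_apply hi] using measurable_pi_apply _
  · simpa only [Function.extend_val_apply' hi] using measurable_const

variable {V : Type*} {T : SimpleGraph V} (hT : T.IsTree)

theorem pathProduct_eval_extend {Ω : Type*} (W : T.Dart → Ω → ℝ) (m : V) (ω : Ω) :
    pathProduct hT Function.eval m
        (Function.extend Subtype.val (fun e : outwardEdges T m => W e ω) 0) =
      pathProduct hT W m ω :=
  funext fun _ => pathProduct_congr hT fun _ hd =>
    Function.extend_val_apply (mem_outwardEdges_of_mem_darts hT hd)

variable [Fintype T.Dart] {ν : T.Dart → Measure ℝ} [∀ e, IsProbabilityMeasure (ν e)]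

theorem treeMeasure_eq_map_extend (m : V) [Fintype (outwardEdges T m)] (ρ : Measure ℝ)
    [SFinite ρ] :
    treeMeasure hT m ρ ν =
      (ρ.prod (Measure.pi fun e : outwardEdges T m => ν e)).map fun q =>
        treeVec hT m (q.1, Function.extend Subtype.val q.2 0) := by
  have hextend := measurable_extend_zero (outwardEdges T m)
  have hprod := (MeasurePreserving.id ρ).prod (measurePreserving_pi_subtype ν (outwardEdges T m))
  rw [← hprod.map_eq, Measure.map_map (by fun_prop) hprod.measurable, treeMeasure_eq_map_treeVec]
  refine congrArg (Measure.map · _) (funext fun q => ?_)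
  exact congrArg (q.1 • ·) (pathProduct_eval_extend hT Function.eval m q.2).symm

variable {Ω : Type*} [MeasurableSpace Ω] {Q : Measure Ω} {W : T.Dart → Ω → ℝ}

theorem hasLaw_pathProduct [IsProbabilityMeasure Q] (m : V) {ρ : Measure ℝ}
    [IsProbabilityMeasure ρ] {P : Ω → ℝ}
    (hP : HasLaw P ρ Q) (hW : ∀ e ∈ outwardEdges T m, HasLaw (W e) (ν e) Q)
    (hI : iIndepFun (fun e : outwardEdges T m => W e) Q)
    (hPI : IndepFun P (fun ω (e : outwardEdges T m) => W e ω) Q) :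
    HasLaw (fun ω i => P ω * pathProduct hT W m ω i) (treeMeasure hT m ρ ν) Q := by
  classical
  have hextend := measurable_extend_zero (outwardEdges T m)
  have htree : HasLaw (fun q : ℝ × (outwardEdges T m → ℝ) =>
      treeVec hT m (q.1, Function.extend Subtype.val q.2 0)) (treeMeasure hT m ρ ν)
      (ρ.prod (Measure.pi fun e : outwardEdges T m => ν e)) :=
    ⟨by fun_prop, (treeMeasure_eq_map_extend hT m ρ).symm⟩
  refine (htree.comp (hPI.hasLaw_prod hP (hI.hasLaw_pi fun e => hW e e.2))).congr ?_
  exact .of_forall fun ω => congrArg (P ω • ·) (pathProduct_eval_extend hT W m ω).symm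

theorem paretoMixture_pathProduct (hW : ∀ e, Measurable (W e)) (hI : iIndepFun W Q) (m : V) :
    paretoMixture (Q.map (pathProduct hT W m)) =
      treeMeasure hT m stdPareto fun e => Q.map (W e) := by
  have hpath : Measurable (pathProduct hT Function.eval m) :=
    measurable_pathProduct hT measurable_pi_apply m
  rw [treeMeasure, ← hI.map_fun_eq_pi_map fun e => (hW e).aemeasurable,
    Measure.map_map hpath (measurable_pi_iff.2 hW)]
  rfl

end OutwardEdges

section Construction

variable {V : Type*} {T : SimpleGraph V} (hT : T.IsTree)

theorem isExtremalFunction_map_pathProduct [Countable V] {Ω : Type*} [MeasurableSpace Ω]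
    {Q : Measure Ω} [IsProbabilityMeasure Q] {W : T.Dart → Ω → ℝ} (hW : ∀ e, Measurable (W e))
    (hnonneg : ∀ᵐ ω ∂Q, ∀ e, 0 ≤ W e ω) {μ : Measure (V → ℝ)} {m : V}
    (hμ : exceedanceLaw μ m = paretoMixture (Q.map (pathProduct hT W m))) :
    IsExtremalFunction μ m (Q.map (pathProduct hT W m)) := by
  have hpath := (measurable_pathProduct hT hW m).aemeasurable (μ := Q)
  refine ⟨Measure.isProbabilityMeasure_map hpath, ?_, ?_, hμ⟩
  · refine (ae_map_iff hpath (by measurability)).2 ?_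
    exact hnonneg.mono fun ω hω => pathProduct_nonneg hT hω m
  · refine (ae_map_iff hpath (measurable_pi_apply m (measurableSet_singleton 1))).2 ?_
    exact .of_forall (pathProduct_self hT W m)

theorem exists_isExponentMeasure_restrict_eq_paretoMixture [Finite V]
    {Ω : Type*} [MeasurableSpace Ω] {Q : Measure Ω} [IsProbabilityMeasure Q]
    {W : T.Dart → Ω → ℝ} (hW : ∀ e, Measurable (W e)) (hnonneg : ∀ e, ∀ᵐ ω ∂Q, 0 ≤ W e ω)
    (hI : iIndepFun W Q) (hdual : ∀ e, BivariateDuality Q (W e) (W e.symm)) :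
    ∃ Λ, IsExponentMeasure Λ ∧
      ∀ m, Λ.restrict {x | 1 < x m} = paretoMixture (Q.map (pathProduct hT W m)) := by
  have hprob (e : T.Dart) : IsProbabilityMeasure (Q.map (W e)) :=
    Measure.isProbabilityMeasure_map (hW e).aemeasurable
  classical
  have := Fintype.ofFinite V
  simp only [paretoMixture_pathProduct hT hW hI]
  exact exists_isExponentMeasure_restrict_eq_treeMeasure hT
    (fun e => (ae_map_iff (hW e).aemeasurable measurableSet_Ici).2 (hnonneg e))
    fun e => (hdual e).lawDuality (hW e) (hW e.symm)

theorem isExtremalGraphicalModel_of_exceedanceLaw_eq [Fintype V] [Fintype T.Dart]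
    {ν : T.Dart → Measure ℝ} [∀ e, IsProbabilityMeasure (ν e)] {μ : Measure (V → ℝ)}
    (hμ : ∀ m, exceedanceLaw μ m = treeMeasure hT m stdPareto ν) :
    IsExtremalGraphicalModel T μ := by
  intro A B C hAB hBC _ hsep m
  have hchain := isTreeMarkovChain_treeMeasure (ν := ν) hT (ρ := stdPareto) m
  simp only [hμ m]
  exact hchain.condIndepFun_of_separates hT hAB hBC hsep

end Construction

end ExtremalTree

open ExtremalTree in
theorem mainTheorem5 {V : Type*} [Fintype V] (T : SimpleGraph V) (hT : T.IsTree) :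
    -- Stochastic representation of an extremal tree model
    (∀ μ : Measure (V → ℝ), IsMultivariatePareto μ → IsExtremalGraphicalModel T μ →
      (∀ i : V, ∃! ν : Measure (V → ℝ), IsExtremalFunction μ i ν) ∧
      ∀ ν : V → Measure (V → ℝ), (∀ i, IsExtremalFunction μ i (ν i)) →
      ∀ (m : V) {Ω : Type*} [MeasurableSpace Ω] (Q : Measure Ω) [IsProbabilityMeasure Q]
        (P : Ω → ℝ) (W : T.Dart → Ω → ℝ),
        HasLaw P stdPareto Q →
        (∀ e ∈ outwardEdges T m, HasLaw (W e) ((ν e.fst).map (fun w => w e.snd)) Q) →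
        iIndepFun (fun e : outwardEdges T m => W e) Q →
        IndepFun P (fun ω (e : outwardEdges T m) => W e ω) Q →
        HasLaw (fun ω i => P ω * pathProduct hT W m ω i) (exceedanceLaw μ m) Q) ∧
    -- Construction of an extremal tree model from its edge variables
    (∀ {Ω : Type*} [MeasurableSpace Ω] (Q : Measure Ω) [IsProbabilityMeasure Q]
      (W : T.Dart → Ω → ℝ),
      (∀ e, Measurable (W e)) → (∀ e, ∀ᵐ ω ∂Q, 0 ≤ W e ω) → iIndepFun W Q →
      (∀ e, BivariateDuality Q (W e) (W e.symm)) →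
      (∀ (m m' : V) (A : Set (V → ℝ)), MeasurableSet A →
        A ⊆ paretoSupportAt m ∩ paretoSupportAt m' →
        paretoMixture (Q.map (pathProduct hT W m)) A =
          paretoMixture (Q.map (pathProduct hT W m')) A) ∧
      ∃ μ : Measure (V → ℝ),
        (IsMultivariatePareto μ ∧
          (∀ m, IsExtremalFunction μ m (Q.map (pathProduct hT W m)))) ∧
        (∀ μ' : Measure (V → ℝ), IsMultivariatePareto μ' →
          (∀ m, IsExtremalFunction μ' m (Q.map (pathProduct hT W m))) → μ' = μ) ∧
        IsExtremalGraphicalModel T μ) := by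
  classical
  have : Fintype T.Dart := Fintype.ofFinite _
  have := hT.connected.nonempty
  refine ⟨fun μ hμ hG => ⟨hμ.existsUnique_isExtremalFunction, ?_⟩, ?_⟩
  · intro ν hν m Ω _ Q _ P W hP hW hI hPI
    have hprob (e : T.Dart) := (hν e.fst).isProbabilityMeasure_map_eval e.snd
    rw [exceedanceLaw_eq_treeMeasure hμ hG hT hν m]
    exact hasLaw_pathProduct hT m hP hW hI hPI
  · intro Ω _ Q _ W hW hnonneg hI hdual
    have hprob (e : T.Dart) := Measure.isProbabilityMeasure_map (μ := Q) (hW e).aemeasurable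
    obtain ⟨Λ, hΛ, hΛ_mix⟩ :=
      exists_isExponentMeasure_restrict_eq_paretoMixture hT hW hnonneg hI hdual
    have hexceed (m : V) := (hΛ.exceedanceLaw_cond m).trans (hΛ_mix m)
    refine ⟨fun m m' A _ hA => ?_, cond Λ (paretoSupport V), ⟨hΛ.isMultivariatePareto_cond,
      fun m => isExtremalFunction_map_pathProduct hT hW (ae_all_iff.2 hnonneg) (hexceed m)⟩,
      fun μ' hμ' hν' => ?_, isExtremalGraphicalModel_of_exceedanceLaw_eq hT fun m =>
        (hexceed m).trans (paretoMixture_pathProduct hT hW hI m)⟩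
    · rw [← hΛ_mix, ← hΛ_mix, Measure.restrict_eq_self, Measure.restrict_eq_self]
      exacts [fun x hx => (hA hx).2.2, fun x hx => (hA hx).1.2]
    · obtain ⟨Λ', hΛ', rfl⟩ := hμ'.exists_isExponentMeasure
      refine hΛ'.cond_paretoSupport_eq hΛ fun m => ?_
      rw [← hΛ'.exceedanceLaw_cond, (hν' m).exceedanceLaw_eq, hΛ_mix]
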